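/- Let $k$ be a commutative ring and let $A$ be an associative unital $k$-algebra. Let $\Delta S_+$ be the category of non-commutative sets: its objects are the sets $\underline{m}=\{1,\dots,m\}$ for $m\ge 0$, and its morphisms are set maps together with a total order on each fibre, composed lexicographically; it is permutative under disjoint union $\odot$. Let $B^{sym_+}_*A\colon \underline{m}\mapsto A^{\otimes m}$ be the symmetric bar construction, on which a morphism $f$ acts by multiplying the factors in each fibre of $f$ in the given order (an empty fibre gives $1$). Let $\mathscr{Y}^+_*A = k[N(-\setminus \Delta S_+)]\otimes_{\Delta S_+}B^{sym_+}_*A$, where $N$ is the nerve and $-\setminus\Delta S_+$ denotes the under-categories. It is a simplicial $k$-module. Let $\mathcal{N}$ be the normalization functor (quotient by degeneracies) from simplicial $k$-modules to chain complexes, and let $HS_*(A)=H_*(\mathcal{N}\mathscr{Y}^+_*A)$ be the symmetric homology of $A$. Let $ES_2$ be the category whose objects are the elements of the symmetric group $S_2$, with exactly one morphism between any two objects. The functors $$ES_2\times(\underline{m}\setminus\Delta S_+)\times(\underline{n}\setminus\Delta S_+)\to(\underline{m}\odot\underline{n})\setminus\Delta S_+,\qquad (\sigma,\ f_1\colon\underline{m}\to\underline{p_1},\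 f_2\colon\underline{n}\to\underline{p_2})\mapsto\sigma\{p_1,p_2\}(f_1\odot f_2),$$ where $\sigma\{p_1,p_2\}$ is the block permutation, together with the juxtaposition of tensors, induce a map of simplicial $k$-modules $\overline{\chi}\colon k[N(ES_2)]\,\widehat{\otimes}\,\mathscr{Y}^+_*A\,\widehat{\otimes}\,\mathscr{Y}^+_*A\to\mathscr{Y}^+_*A$, where $\widehat{\otimes}$ is the degreewise tensor product. Let $\widetilde{\chi}\colon \mathcal{N}k[N(ES_2)]\otimes\mathcal{N}\mathscr{Y}^+_*A\otimes\mathcal{N}\mathscr{Y}^+_*A\to\mathcal{N}\mathscr{Y}^+_*A$ be its composite with the Eilenberg--Zilber shuffle maps. The Pontryagin product on $HS_*(A)$ is $[x]\cdot[y]=[\widetilde{\chi}(c\otimes x\otimes y)]$, where $c\in k[N(ES_2)]_0=k[S_2]$ is any $0$-chain whose coefficients have sum $1$. Let $([A,A])$ be the two-sided ideal of $A$ generated by all commutators $ab-ba$. Then the map that sends $a\in A$ to the class of $(\mathrm{id}_{\underline{1}})\otimes a$ induces an isomorphism of $k$-modules $A/([A,A])\cong HS_0(A)$. Under this identification, the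 Pontryagin product restricted to $HS_0(A)\otimes HS_0(A)\to HS_0(A)$ is, for every such $c$, the standard multiplication $A/([A,A])\otimes A/([A,A])\to A/([A,A])$. -/

import Mathlib

universe u v w w₁ w₂

open CategoryTheory Opposite TensorProduct

namespace SymHom

/-! ### Shuffles

In this section a simplicial `k`-module is given by its modules `A n`, its faces `d n i` and its
degeneracies `s n i`. Forgetting `d 0` and `s 0` and lowering the degree by one gives again a
simplicial module, the shifted one (décalage), with modules `A (n + 1)`. -/

section Shuffle
variable {k : Type u} [CommRing k]

/-- The simplicial identities between faces and degeneracies and between degeneracies. -/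
structure IsSimp (A : ℕ → Type w) [∀ n, AddCommGroup (A n)] [∀ n, Module k (A n)]
    (d : ∀ n, Fin (n + 2) → A (n + 1) →ₗ[k] A n)
    (s : ∀ n, Fin (n + 1) → A n →ₗ[k] A (n + 1)) : Prop where
  ds_self : ∀ n (i : Fin (n + 1)) (x : A n), d n i.castSucc (s n i x) = x
  ds_succ : ∀ n (i : Fin (n + 1)) (x : A n), d n i.succ (s n i x) = x
  ds_le : ∀ n (i : Fin (n + 2)) (j : Fin (n + 1)) (x : A (n + 1)), i ≤ j.castSucc →
    d (n + 1) i.castSucc (s (n + 1) j.succ x) = s n j (d n i x)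
  ds_gt : ∀ n (i : Fin (n + 2)) (j : Fin (n + 1)) (x : A (n + 1)), j.castSucc < i →
    d (n + 1) i.succ (s (n + 1) j.castSucc x) = s n j (d n i x)
  ss : ∀ n (i j : Fin (n + 1)) (x : A n), i ≤ j →
    s (n + 1) i.castSucc (s n j x) = s (n + 1) j.succ (s n i x)

/-- The alternating sum `∑ (-1)^i d_i` of the faces. -/
def bdry {A : ℕ → Type w} [∀ n, AddCommGroup (A n)] [∀ n, Module k (A n)]
    (d : ∀ n, Fin (n + 2) → A (n + 1) →ₗ[k] A n) (n : ℕ) : A (n + 1) →ₗ[k] A n :=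
  ∑ i : Fin (n + 2), (-1 : k) ^ (i : ℕ) • d n i

/-- The sum `∑ (-1)^i d_(i+1)`, so that `bdry = d_0 - tail`. It only serves in proofs. -/
def tail {A : ℕ → Type w} [∀ n, AddCommGroup (A n)] [∀ n, Module k (A n)]
    (d : ∀ n, Fin (n + 2) → A (n + 1) →ₗ[k] A n) (n : ℕ) : A (n + 1) →ₗ[k] A n :=
  ∑ i : Fin (n + 1), (-1 : k) ^ (i : ℕ) • d n i.succ

/-- The submodule spanned by all degenerate elements. -/
def degenerate {A : ℕ → Type w} [∀ n, AddCommGroup (A n)] [∀ n, Module k (A n)]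
    (s : ∀ n, Fin (n + 1) → A n →ₗ[k] A (n + 1)) : ∀ n, Submodule k (A n)
  | 0 => ⊥
  | n + 1 => ⨆ i : Fin (n + 1), LinearMap.range (s n i)

/-- The Eilenberg-Zilber shuffle map `A_p ⊗ B_q → A_n ⊗ B_n` for `n = p + q`,
`x ⊗ y ↦ ∑ sgn(μ, ν) s_ν x ⊗ s_μ y`, the sum being over all `(p, q)`-shuffles, that is, over all
monotone lattice paths from `(0, 0)` to `(p, q)`. The sum is split according to the first step of
the path. After a step in the first direction, the factor in `B` is `s_0 y` and the rest of the path
is a `(p - 1, q)`-shuffle in the shifted modules. After a step in the second direction, the factor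
in `A` is `s_0 x`, the rest is a `(p, q - 1)`-shuffle, and the sign is `(-1)^p` because the step
is moved past `p` steps in the first direction. -/
noncomputable def shuffle : ∀ (n : ℕ)
    {A : ℕ → Type w₁} [∀ n, AddCommGroup (A n)] [∀ n, Module k (A n)]
    (_ : ∀ n, Fin (n + 1) → A n →ₗ[k] A (n + 1))
    {B : ℕ → Type w₂} [∀ n, AddCommGroup (B n)] [∀ n, Module k (B n)]
    (_ : ∀ n, Fin (n + 1) → B n →ₗ[k] B (n + 1))
    (p q : ℕ) (_ : p + q = n), A p →ₗ[k] B q →ₗ[k] A n ⊗[k] B n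
  | 0, A, _, _, _, B, _, _, _, p, q, h =>
    match p, q, h with
      | 0, 0, _ => TensorProduct.mk k (A 0) (B 0)
      | 0, _ + 1, h => absurd h (by omega)
      | _ + 1, _, h => absurd h (by omega)
  | n + 1, A, _, _, sA, B, _, _, sB, p, q, h =>
    (match p, h with
      | 0, _ => 0
      | p + 1, h =>
        (shuffle n (A := fun m => A (m + 1)) (fun m i => sA (m + 1) i.succ)
          (B := fun m => B (m + 1)) (fun m i => sB (m + 1) i.succ) p q (by omega)).compl₂ (sB q 0))
    + (match q, h with
      | 0, _ => 0
      | q + 1, h =>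
        (-1 : k) ^ p • (shuffle n (A := fun m => A (m + 1)) (fun m i => sA (m + 1) i.succ)
          (B := fun m => B (m + 1)) (fun m i => sB (m + 1) i.succ) p q (by omega)).comp (sA p 0))

section lemmas
variable {A : ℕ → Type w₁} [∀ n, AddCommGroup (A n)] [∀ n, Module k (A n)]
  {d : ∀ n, Fin (n + 2) → A (n + 1) →ₗ[k] A n} {s : ∀ n, Fin (n + 1) → A n →ₗ[k] A (n + 1)}

theorem IsSimp.dec (h : IsSimp A d s) :
    IsSimp (fun n => A (n + 1)) (fun n i => d (n + 1) i.succ) (fun n i => s (n + 1) i.succ) where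
  ds_self n i x := h.ds_self (n + 1) i.succ x
  ds_succ n i x := h.ds_succ (n + 1) i.succ x
  ds_le n i j x hij := h.ds_le (n + 1) i.succ j.succ x (Fin.succ_le_succ_iff.mpr hij)
  ds_gt n i j x hij := h.ds_gt (n + 1) i.succ j.succ x (Fin.succ_lt_succ_iff.mpr hij)
  ss n i j x hij := h.ss (n + 1) i.succ j.succ x (Fin.succ_le_succ_iff.mpr hij)

theorem IsSimp.d0s0 (h : IsSimp A d s) (n) (x : A n) : d n 0 (s n 0 x) = x := h.ds_self n 0 x
theorem IsSimp.d0s (h : IsSimp A d s) (n) (j : Fin (n + 1)) (x : A (n + 1)) :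
    d (n + 1) 0 (s (n + 1) j.succ x) = s n j (d n 0 x) := h.ds_le n 0 j x (by simp)
theorem IsSimp.s0s (h : IsSimp A d s) (n) (j : Fin (n + 1)) (x : A n) :
    s (n + 1) j.succ (s n 0 x) = s (n + 1) 0 (s n j x) :=
  (h.ss n 0 j x (by simp)).symm

theorem bdry_eq (n) (x : A (n + 1)) : bdry d n x = d n 0 x - tail d n x := by
  simp only [bdry, tail, LinearMap.sum_apply]
  rw [Fin.sum_univ_succ]
  simp [pow_succ, sub_eq_add_neg]

theorem tail_succ (n) : tail d (n + 1) =
    bdry (A := fun m => A (m + 1)) (fun m i => d (m + 1) i.succ) n := rfl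

theorem IsSimp.tail_s0 (h : IsSimp A d s) (n) (x : A (n + 1)) :
    tail d (n + 1) (s (n + 1) 0 x) = x - s n 0 (tail d n x) := by
  simp only [tail, LinearMap.sum_apply, LinearMap.smul_apply]
  rw [Fin.sum_univ_succ]
  have h1 : d (n + 1) 1 (s (n + 1) 0 x) = x := h.ds_succ (n + 1) 0 x
  have h2 : ∀ i : Fin (n + 1), d (n + 1) i.succ.succ (s (n + 1) 0 x) = s n 0 (d n i.succ x) :=
    fun i => h.ds_gt n i.succ 0 x (by simp [Fin.lt_def])
  simp [h1, h2, pow_succ, sub_eq_add_neg]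

theorem s_mem_degenerate (n) (i : Fin (n + 1)) (x : A n) : s n i x ∈ degenerate s (n + 1) :=
  Submodule.mem_iSup_of_mem (p := fun i => LinearMap.range (s n i)) i ⟨x, rfl⟩

theorem degenerate_le (n) (P : Submodule k (A (n + 1))) (h : ∀ i x, s n i x ∈ P) :
    degenerate s (n + 1) ≤ P := by
  refine iSup_le fun i => ?_
  rintro _ ⟨x, rfl⟩
  exact h i x

theorem degenerate_dec (n) (x : A (n + 1))
    (hx : x ∈ degenerate (A := fun m => A (m + 1)) (fun m i => s (m + 1) i.succ) n) :
    x ∈ degenerate s (n + 1) := by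
  cases n with
  | zero => rw [show x = 0 from hx]; exact zero_mem _
  | succ n =>
    refine degenerate_le (A := fun m => A (m + 1)) (s := fun m i => s (m + 1) i.succ) n
      (degenerate s (n + 2)) (fun i x => ?_) hx
    exact s_mem_degenerate (s := s) _ _ _

theorem bdry_s (n) : ∀ {A : ℕ → Type w₁} [∀ n, AddCommGroup (A n)] [∀ n, Module k (A n)]
    {d : ∀ n, Fin (n + 2) → A (n + 1) →ₗ[k] A n} {s : ∀ n, Fin (n + 1) → A n →ₗ[k] A (n + 1)}
    (_ : IsSimp A d s) (i : Fin (n + 1)) (x : A n), bdry d n (s n i x) ∈ degenerate s n := by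
  induction n with
  | zero =>
    intro A _ _ d s h i x
    obtain rfl : i = 0 := by omega
    have h1 : d 0 1 (s 0 0 x) = x := h.ds_succ 0 0 x
    rw [bdry_eq, h.d0s0]
    simp [tail, h1]
  | succ n ih =>
    intro A _ _ d s h i x
    rw [bdry_eq]
    refine Fin.cases ?_ (fun j => ?_) i
    · rw [h.d0s0, h.tail_s0, sub_sub_cancel]
      exact s_mem_degenerate _ _ _
    · rw [h.d0s]
      exact sub_mem (s_mem_degenerate _ _ _) (degenerate_dec _ _ (ih h.dec j x))

theorem bdry_degenerate (h : IsSimp A d s) (n) :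
    degenerate s (n + 1) ≤ (degenerate s n).comap (bdry d n) :=
  degenerate_le _ _ fun i x => bdry_s n h i x
end lemmas

section lemmas2
variable {A : ℕ → Type w₁} [∀ n, AddCommGroup (A n)] [∀ n, Module k (A n)]
  {dA : ∀ n, Fin (n + 2) → A (n + 1) →ₗ[k] A n} {sA : ∀ n, Fin (n + 1) → A n →ₗ[k] A (n + 1)}
variable {B : ℕ → Type w₂} [∀ n, AddCommGroup (B n)] [∀ n, Module k (B n)]
  {dB : ∀ n, Fin (n + 2) → B (n + 1) →ₗ[k] B n} {sB : ∀ n, Fin (n + 1) → B n →ₗ[k] B (n + 1)}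


theorem shuffle_zero (x : A 0) (y : B 0) (h : 0 + 0 = 0) :
    shuffle 0 sA sB 0 0 h x y = x ⊗ₜ[k] y := by simp [shuffle]

theorem shuffle_left (n p) (h : p + 1 + 0 = n + 1) (x : A (p + 1)) (y : B 0) :
    shuffle (n + 1) sA sB (p + 1) 0 h x y =
      shuffle n (A := fun m => A (m + 1)) (fun m i => sA (m + 1) i.succ)
          (B := fun m => B (m + 1)) (fun m i => sB (m + 1) i.succ) p 0 (by omega) x (sB 0 0 y) := by
  simp [shuffle]

theorem shuffle_right (n q) (h : 0 + (q + 1) = n + 1) (x : A 0) (y : B (q + 1)) :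
    shuffle (n + 1) sA sB 0 (q + 1) h x y =
      shuffle n (A := fun m => A (m + 1)) (fun m i => sA (m + 1) i.succ)
          (B := fun m => B (m + 1)) (fun m i => sB (m + 1) i.succ) 0 q (by omega) (sA 0 0 x) y := by
  simp [shuffle]

theorem shuffle_both (n p q) (h : p + 1 + (q + 1) = n + 1) (x : A (p + 1)) (y : B (q + 1)) :
    shuffle (n + 1) sA sB (p + 1) (q + 1) h x y =
      shuffle n (A := fun m => A (m + 1)) (fun m i => sA (m + 1) i.succ)
          (B := fun m => B (m + 1)) (fun m i => sB (m + 1) i.succ) p (q + 1) (by omega)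
          x (sB (q + 1) 0 y) +
      (-1 : k) ^ (p + 1) • shuffle n (A := fun m => A (m + 1)) (fun m i => sA (m + 1) i.succ)
          (B := fun m => B (m + 1)) (fun m i => sB (m + 1) i.succ) (p + 1) q (by omega)
          (sA (p + 1) 0 x) y := by
  simp [shuffle]
end lemmas2

/-- The shuffle map is natural. -/
theorem shuffle_nat (n : ℕ) : ∀
    {A : ℕ → Type w₁} [∀ n, AddCommGroup (A n)] [∀ n, Module k (A n)]
    {sA : ∀ n, Fin (n + 1) → A n →ₗ[k] A (n + 1)}
    {B : ℕ → Type w₂} [∀ n, AddCommGroup (B n)] [∀ n, Module k (B n)]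
    {sB : ∀ n, Fin (n + 1) → B n →ₗ[k] B (n + 1)}
    {A' : ℕ → Type w₁} [∀ n, AddCommGroup (A' n)] [∀ n, Module k (A' n)]
    {sA' : ∀ n, Fin (n + 1) → A' n →ₗ[k] A' (n + 1)}
    {B' : ℕ → Type w₂} [∀ n, AddCommGroup (B' n)] [∀ n, Module k (B' n)]
    {sB' : ∀ n, Fin (n + 1) → B' n →ₗ[k] B' (n + 1)}
    (f : ∀ n, A n →ₗ[k] A' n) (g : ∀ n, B n →ₗ[k] B' n)
    (_ : ∀ n i x, f (n + 1) (sA n i x) = sA' n i (f n x))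
    (_ : ∀ n i x, g (n + 1) (sB n i x) = sB' n i (g n x))
    (p q : ℕ) (h : p + q = n) (x : A p) (y : B q),
    TensorProduct.map (f n) (g n) (shuffle n sA sB p q h x y) =
      shuffle n sA' sB' p q h (f p x) (g q y) := by
  induction n with
  | zero =>
    intro A _ _ sA B _ _ sB A' _ _ sA' B' _ _ sB' f g hf hg p q h x y
    obtain ⟨rfl, rfl⟩ : p = 0 ∧ q = 0 := by omega
    simp [shuffle_zero]
  | succ n ih =>
    intro A _ _ sA B _ _ sB A' _ _ sA' B' _ _ sB' f g hf hg p q h x y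
    have ih' := ih (A := fun m => A (m + 1)) (B := fun m => B (m + 1))
      (A' := fun m => A' (m + 1)) (B' := fun m => B' (m + 1))
      (sA := fun m i => sA (m + 1) i.succ) (sB := fun m i => sB (m + 1) i.succ)
      (sA' := fun m i => sA' (m + 1) i.succ) (sB' := fun m i => sB' (m + 1) i.succ)
      (fun m => f (m + 1)) (fun m => g (m + 1))
      (fun m i x => hf _ _ _) (fun m i x => hg _ _ _)
    match p, q, h with
    | 0, q + 1, h => rw [shuffle_right, shuffle_right, ← hf]; exact ih' _ _ _ _ _
    | p + 1, 0, h => rw [shuffle_left, shuffle_left, ← hg]; exact ih' _ _ _ _ _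
    | p + 1, q + 1, h =>
      rw [shuffle_both, shuffle_both, ← hg, ← hf, map_add, map_smul]
      exact congrArg₂ _ (ih' _ _ _ _ _) (congrArg _ (ih' _ _ _ _ _))

/-- `Sh (s₀ x, s₀ y)` in the shifted modules is `s₀ Sh (x, y)`. -/
theorem shuffle_s0 (n : ℕ) 
    {A : ℕ → Type w₁} [∀ n, AddCommGroup (A n)] [∀ n, Module k (A n)]
    {dA : ∀ n, Fin (n + 2) → A (n + 1) →ₗ[k] A n}
    {sA : ∀ n, Fin (n + 1) → A n →ₗ[k] A (n + 1)}
    {B : ℕ → Type w₂} [∀ n, AddCommGroup (B n)] [∀ n, Module k (B n)]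
    {dB : ∀ n, Fin (n + 2) → B (n + 1) →ₗ[k] B n}
    {sB : ∀ n, Fin (n + 1) → B n →ₗ[k] B (n + 1)}
    (hA : IsSimp A dA sA) (hB : IsSimp B dB sB)
    (p q : ℕ) (h : p + q = n) (x : A p) (y : B q) :
    shuffle n (A := fun m => A (m + 1)) (fun m i => sA (m + 1) i.succ)
      (B := fun m => B (m + 1)) (fun m i => sB (m + 1) i.succ) p q h (sA p 0 x) (sB q 0 y) =
    TensorProduct.map (sA n 0) (sB n 0) (shuffle n sA sB p q h x y) := by
  cases n with
  | zero =>
    obtain ⟨rfl, rfl⟩ : p = 0 ∧ q = 0 := by omega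
    simp [shuffle_zero]
  | succ n =>
    have key := shuffle_nat (k := k) n (A := fun m => A (m + 1)) (B := fun m => B (m + 1))
      (A' := fun m => A (m + 2)) (B' := fun m => B (m + 2))
      (sA := fun m i => sA (m + 1) i.succ) (sB := fun m i => sB (m + 1) i.succ)
      (sA' := fun m i => sA (m + 2) i.succ.succ) (sB' := fun m i => sB (m + 2) i.succ.succ)
      (fun m => sA (m + 1) 0) (fun m => sB (m + 1) 0)
      (fun m i x => hA.ss (m + 1) 0 i.succ x (by simp))
      (fun m i x => hB.ss (m + 1) 0 i.succ x (by simp))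
    match p, q, h with
    | 0, q + 1, h =>
      rw [shuffle_right, shuffle_right, hA.s0s]; exact (key _ _ _ _ _).symm
    | p + 1, 0, h =>
      rw [shuffle_left, shuffle_left, hB.s0s]; exact (key _ _ _ _ _).symm
    | p + 1, q + 1, h =>
      rw [shuffle_both, shuffle_both, hA.s0s, hB.s0s, map_add, map_smul]
      exact (congrArg₂ _ (key _ _ _ _ _) (congrArg _ (key _ _ _ _ _))).symm

/-- Shuffles of degenerate elements are degenerate. -/
theorem shuffle_degenerate (n : ℕ) : ∀
    {A : ℕ → Type w₁} [∀ n, AddCommGroup (A n)] [∀ n, Module k (A n)]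
    {dA : ∀ n, Fin (n + 2) → A (n + 1) →ₗ[k] A n}
    {sA : ∀ n, Fin (n + 1) → A n →ₗ[k] A (n + 1)}
    {B : ℕ → Type w₂} [∀ n, AddCommGroup (B n)] [∀ n, Module k (B n)]
    {dB : ∀ n, Fin (n + 2) → B (n + 1) →ₗ[k] B n}
    {sB : ∀ n, Fin (n + 1) → B n →ₗ[k] B (n + 1)}
    (_ : IsSimp A dA sA) (_ : IsSimp B dB sB),
    (∀ (p q : ℕ) (h : p + 1 + q = n) (i : Fin (p + 1)) (x : A p) (y : B q),
      shuffle n sA sB (p + 1) q h (sA p i x) y ∈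
        degenerate (fun n i => TensorProduct.map (sA n i) (sB n i)) n) ∧
    (∀ (p q : ℕ) (h : p + (q + 1) = n) (i : Fin (q + 1)) (x : A p) (y : B q),
      shuffle n sA sB p (q + 1) h x (sB q i y) ∈
        degenerate (fun n i => TensorProduct.map (sA n i) (sB n i)) n) := by
  induction n with
  | zero =>
    intros
    exact ⟨fun p q h => by omega, fun p q h => by omega⟩
  | succ n ih =>
    intro A _ _ dA sA B _ _ dB sB hA hB
    obtain ⟨ih1, ih2⟩ := ih hA.dec hB.dec
    have up : ∀ z, z ∈ degenerate (A := fun m => A (m + 1) ⊗[k] B (m + 1)) (fun n i =>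
        TensorProduct.map (sA (n + 1) i.succ) (sB (n + 1) i.succ)) n → z ∈
        degenerate (fun n i => TensorProduct.map (sA n i) (sB n i)) (n + 1) := fun z hz =>
      degenerate_dec (A := fun m => A m ⊗[k] B m)
        (s := fun n i => TensorProduct.map (sA n i) (sB n i)) n z hz
    have s0 : ∀ p q h (x : A p) (y : B q),
        shuffle n (A := fun m => A (m + 1)) (fun m i => sA (m + 1) i.succ)
          (B := fun m => B (m + 1)) (fun m i => sB (m + 1) i.succ) p q h (sA p 0 x) (sB q 0 y) ∈
        degenerate (fun n i => TensorProduct.map (sA n i) (sB n i)) (n + 1) := by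
      intro p q h x y
      rw [shuffle_s0 n hA hB]
      exact s_mem_degenerate (A := fun m => A m ⊗[k] B m)
        (s := fun n i => TensorProduct.map (sA n i) (sB n i)) n 0 _
    constructor
    · intro p q h i x y
      have H : shuffle n (A := fun m => A (m + 1)) (fun m i => sA (m + 1) i.succ)
          (B := fun m => B (m + 1)) (fun m i => sB (m + 1) i.succ) p q (by omega)
            (sA p i x) (sB q 0 y) ∈
          degenerate (fun n i => TensorProduct.map (sA n i) (sB n i)) (n + 1) := by
        revert x
        refine Fin.cases ?_ (fun j => ?_) i
        · intro x; exact s0 _ _ _ _ _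
        · intro x
          cases p with
          | zero => exact j.elim0
          | succ p => exact up _ (ih1 p q (by omega) j x _)
      match q, h, y, H with
      | 0, h, y, H => rw [shuffle_left]; exact H
      | q + 1, h, y, H =>
        rw [shuffle_both]
        refine add_mem H (Submodule.smul_mem _ _ ?_)
        rw [← hA.s0s]
        exact up _ (ih1 p q (by omega) i _ _)
    · intro p q h i x y
      have H : shuffle n (A := fun m => A (m + 1)) (fun m i => sA (m + 1) i.succ)
          (B := fun m => B (m + 1)) (fun m i => sB (m + 1) i.succ) p q (by omega)
            (sA p 0 x) (sB q i y) ∈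
          degenerate (fun n i => TensorProduct.map (sA n i) (sB n i)) (n + 1) := by
        revert y
        refine Fin.cases ?_ (fun j => ?_) i
        · intro y; exact s0 _ _ _ _ _
        · intro y
          cases q with
          | zero => exact j.elim0
          | succ q => exact up _ (ih2 p q (by omega) j _ y)
      match p, h, x, H with
      | 0, h, x, H => rw [shuffle_right]; exact H
      | p + 1, h, x, H =>
        rw [shuffle_both]
        refine add_mem ?_ (Submodule.smul_mem _ _ H)
        rw [← hB.s0s]
        exact up _ (ih2 p q (by omega) i _ _)

/-- The shuffle map is a chain map: `∂(x × y) = ∂x × y + (-1)^p x × ∂y`. -/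
theorem shuffle_leibniz (n : ℕ) : ∀
    {A : ℕ → Type w₁} [∀ n, AddCommGroup (A n)] [∀ n, Module k (A n)]
    {dA : ∀ n, Fin (n + 2) → A (n + 1) →ₗ[k] A n}
    {sA : ∀ n, Fin (n + 1) → A n →ₗ[k] A (n + 1)}
    {B : ℕ → Type w₂} [∀ n, AddCommGroup (B n)] [∀ n, Module k (B n)]
    {dB : ∀ n, Fin (n + 2) → B (n + 1) →ₗ[k] B n}
    {sB : ∀ n, Fin (n + 1) → B n →ₗ[k] B (n + 1)}
    (_ : IsSimp A dA sA) (_ : IsSimp B dB sB),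
    (∀ (p : ℕ) (h : p + 1 + 0 = n + 1) (x : A (p + 1)) (y : B 0),
      bdry (A := fun m => A m ⊗[k] B m) (fun n i => TensorProduct.map (dA n i) (dB n i)) n (shuffle (n + 1) sA sB (p + 1) 0 h x y)
        = shuffle n sA sB p 0 (by omega) (bdry dA p x) y) ∧
    (∀ (q : ℕ) (h : 0 + (q + 1) = n + 1) (x : A 0) (y : B (q + 1)),
      bdry (A := fun m => A m ⊗[k] B m) (fun n i => TensorProduct.map (dA n i) (dB n i)) n (shuffle (n + 1) sA sB 0 (q + 1) h x y)
        = shuffle n sA sB 0 q (by omega) x (bdry dB q y)) ∧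
    (∀ (p q : ℕ) (h : p + 1 + (q + 1) = n + 1) (x : A (p + 1)) (y : B (q + 1)),
      bdry (A := fun m => A m ⊗[k] B m) (fun n i => TensorProduct.map (dA n i) (dB n i)) n
          (shuffle (n + 1) sA sB (p + 1) (q + 1) h x y)
        = shuffle n sA sB p (q + 1) (by omega) (bdry dA p x) y +
          (-1 : k) ^ (p + 1) • shuffle n sA sB (p + 1) q (by omega) x (bdry dB q y)) := by
  induction n with
  | zero =>
    intro A _ _ dA sA B _ _ dB sB hA hB
    refine ⟨fun p h x y => ?_, fun q h x y => ?_, fun p q h => by omega⟩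
    · obtain rfl : p = 0 := by omega
      have h1 : dB 0 1 (sB 0 0 y) = y := hB.ds_succ 0 0 y
      rw [shuffle_left, shuffle_zero, shuffle_zero, bdry_eq, bdry_eq]
      simp [tail, h1, hB.d0s0, TensorProduct.sub_tmul]
    · obtain rfl : q = 0 := by omega
      have h1 : dA 0 1 (sA 0 0 x) = x := hA.ds_succ 0 0 x
      rw [shuffle_right, shuffle_zero, shuffle_zero, bdry_eq, bdry_eq]
      simp [tail, h1, hA.d0s0, TensorProduct.tmul_sub]
  | succ n ih =>
    intro A _ _ dA sA B _ _ dB sB hA hB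
    obtain ⟨ih1, ih2, ih3⟩ := ih hA.dec hB.dec
    have nat := shuffle_nat (k := k) (n + 1) (A := fun m => A (m + 1)) (B := fun m => B (m + 1))
      (sA := fun m i => sA (m + 1) i.succ) (sB := fun m i => sB (m + 1) i.succ)
      (sA' := sA) (sB' := sB)
      (fun m => dA m 0) (fun m => dB m 0) (fun m i x => hA.d0s _ _ _) (fun m i x => hB.d0s _ _ _)
    simp only [← tail_succ] at ih1 ih2 ih3
    have tl : tail (A := fun m => A m ⊗[k] B m) (fun n i => TensorProduct.map (dA n i) (dB n i))
      (n + 1) = bdry (A := fun m => A (m + 1) ⊗[k] B (m + 1))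
        (fun n i => TensorProduct.map (dA (n + 1) i.succ) (dB (n + 1) i.succ)) n := rfl
    refine ⟨fun p h x y => ?_, fun q h x y => ?_, fun p q h x y => ?_⟩
    · obtain rfl : p = n + 1 := by omega
      have e1 := nat (n + 1) 0 (by omega) x (sB 0 0 y)
      have e2 := ih1 n (by omega) x (sB 0 0 y)
      rw [hB.d0s0] at e1
      rw [bdry_eq, bdry_eq, tl, shuffle_left, map_sub, LinearMap.sub_apply,
        shuffle_left n n _ (tail dA (n + 1) x)]
      exact congrArg₂ _ e1 e2
    · obtain rfl : q = n + 1 := by omega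
      have e1 := nat 0 (n + 1) (by omega) (sA 0 0 x) y
      have e2 := ih2 n (by omega) (sA 0 0 x) y
      rw [hA.d0s0] at e1
      rw [bdry_eq, bdry_eq, tl, shuffle_right, map_sub,
        shuffle_right n n _ _ (tail dB (n + 1) y)]
      exact congrArg₂ _ e1 e2
    · have e1 := nat p (q + 1) (by omega) x (sB (q + 1) 0 y)
      have e2 := nat (p + 1) q (by omega) (sA (p + 1) 0 x) y
      rw [hB.d0s0] at e1
      rw [hA.d0s0] at e2
      have Hd : bdry (A := fun m => A m ⊗[k] B m)
          (fun n i => TensorProduct.map (dA n i) (dB n i)) (n + 1)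
            (shuffle (n + 1 + 1) sA sB (p + 1) (q + 1) h x y) =
          (shuffle (n + 1) sA sB p (q + 1) (by omega) (dA p 0 x) y +
          (-1 : k) ^ (p + 1) • shuffle (n + 1) sA sB (p + 1) q (by omega) x (dB q 0 y)) -
          (bdry (A := fun m => A (m + 1) ⊗[k] B (m + 1))
            (fun n i => TensorProduct.map (dA (n + 1) i.succ) (dB (n + 1) i.succ)) n
            (shuffle (n + 1) (A := fun m => A (m + 1)) (fun m i => sA (m + 1) i.succ)
              (B := fun m => B (m + 1)) (fun m i => sB (m + 1) i.succ) p (q + 1) (by omega)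
              x (sB (q + 1) 0 y)) +
          (-1 : k) ^ (p + 1) • bdry (A := fun m => A (m + 1) ⊗[k] B (m + 1))
            (fun n i => TensorProduct.map (dA (n + 1) i.succ) (dB (n + 1) i.succ)) n
            (shuffle (n + 1) (A := fun m => A (m + 1)) (fun m i => sA (m + 1) i.succ)
              (B := fun m => B (m + 1)) (fun m i => sB (m + 1) i.succ) (p + 1) q (by omega)
              (sA (p + 1) 0 x) y)) := by
        rw [bdry_eq, tl, shuffle_both, map_add, map_smul, ← e1, ← e2]
        exact congrArg _ (by rw [map_add, map_smul])
      rw [Hd, bdry_eq (d := dA), bdry_eq (d := dB)]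
      match p, q, h, x, y with
      | 0, 0, h, x, y =>
        obtain rfl : n = 0 := by omega
        have e3 := ih2 0 (by omega) x (sB (0 + 1) 0 y)
        have e4 := ih1 0 (by omega) (sA (0 + 1) 0 x) y
        rw [hB.tail_s0] at e3
        rw [hA.tail_s0] at e4
        rw [e3, e4, map_sub (shuffle (0 + 1) sA sB 0 (0 + 1) _), LinearMap.sub_apply,
          map_sub (shuffle (0 + 1) sA sB (0 + 1) 0 _ x), shuffle_right 0 0 _ (tail dA 0 x),
          shuffle_left 0 0 _ _ (tail dB 0 y)]
        simp only [map_sub, LinearMap.sub_apply]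
        module
      | 0, q + 1, h, x, y =>
        have e3 := ih2 (q + 1) (by omega) x (sB (q + 1 + 1) 0 y)
        have e4 := ih3 0 q (by omega) (sA (0 + 1) 0 x) y
        rw [hB.tail_s0] at e3
        rw [hA.tail_s0] at e4
        rw [e3, e4, map_sub (shuffle (n + 1) sA sB 0 (q + 1 + 1) _), LinearMap.sub_apply,
          map_sub (shuffle (n + 1) sA sB (0 + 1) (q + 1) _ x), shuffle_right n (q + 1) _ (tail dA 0 x),
          shuffle_both n 0 q _ _ (tail dB (q + 1) y)]
        simp only [map_sub, LinearMap.sub_apply]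
        module
      | p + 1, 0, h, x, y =>
        have e3 := ih3 p 0 (by omega) x (sB (0 + 1) 0 y)
        have e4 := ih1 (p + 1) (by omega) (sA (p + 1 + 1) 0 x) y
        rw [hB.tail_s0] at e3
        rw [hA.tail_s0] at e4
        rw [e3, e4, map_sub (shuffle (n + 1) sA sB (p + 1) (0 + 1) _), LinearMap.sub_apply,
          map_sub (shuffle (n + 1) sA sB (p + 1 + 1) 0 _ x), shuffle_both n p 0 _ (tail dA (p + 1) x),
          shuffle_left n (p + 1) _ _ (tail dB 0 y)]
        simp only [map_sub, LinearMap.sub_apply]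
        module
      | p + 1, q + 1, h, x, y => 
        have e3 := ih3 p (q + 1) (by omega) x (sB (q + 1 + 1) 0 y)
        have e4 := ih3 (p + 1) q (by omega) (sA (p + 1 + 1) 0 x) y
        rw [hB.tail_s0] at e3
        rw [hA.tail_s0] at e4
        rw [e3, e4, map_sub (shuffle (n + 1) sA sB (p + 1) (q + 1 + 1) _), LinearMap.sub_apply,
          map_sub (shuffle (n + 1) sA sB (p + 1 + 1) (q + 1) _ x),
          shuffle_both n p (q + 1) _ (tail dA (p + 1) x),
          shuffle_both n (p + 1) q _ _ (tail dB (q + 1) y)]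
        simp only [map_sub, LinearMap.sub_apply]
        module

end Shuffle

/-! ### Homology of simplicial modules -/

section Homology
variable {k : Type u} [CommRing k]

/-- The module of `n`-simplices of a simplicial module. -/
abbrev Deg (X : SimplicialObject (ModuleCat.{w} k)) (n : ℕ) : Type w := X.obj (op (SimplexCategory.mk n))

abbrev face (X : SimplicialObject (ModuleCat.{w} k)) (n : ℕ) (i : Fin (n + 2)) :
    Deg X (n + 1) →ₗ[k] Deg X n := (X.δ i).hom

abbrev degen (X : SimplicialObject (ModuleCat.{w} k)) (n : ℕ) (i : Fin (n + 1)) :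
    Deg X n →ₗ[k] Deg X (n + 1) := (X.σ i).hom

theorem isSimp (X : SimplicialObject (ModuleCat.{w} k)) :
    IsSimp (Deg X) (face X) (degen X) where
  ds_self n i x := congrArg (fun f => f.hom x) (X.δ_comp_σ_self (i := i))
  ds_succ n i x := congrArg (fun f => f.hom x) (X.δ_comp_σ_succ (i := i))
  ds_le n i j x h := congrArg (fun f => f.hom x) (X.δ_comp_σ_of_le h)
  ds_gt n i j x h := congrArg (fun f => f.hom x) (X.δ_comp_σ_of_gt h)
  ss n i j x h := congrArg (fun f => f.hom x) (X.σ_comp_σ h)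

/-- Degree `n` of the normalized complex: simplices modulo degeneracies. -/
abbrev Norm (X : SimplicialObject (ModuleCat.{w} k)) (n : ℕ) : Type w :=
  Deg X n ⧸ degenerate (degen X) n

/-- The differential of the normalized complex. -/
def normBdry (X : SimplicialObject (ModuleCat.{w} k)) (n : ℕ) : Norm X (n + 1) →ₗ[k] Norm X n :=
  Submodule.mapQ _ _ (bdry (face X) n) (bdry_degenerate (isSimp X) n)

/-- Cycles of the normalized complex. -/
def cycles (X : SimplicialObject (ModuleCat.{w} k)) : ∀ n, Submodule k (Norm X n)
  | 0 => ⊤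
  | n + 1 => LinearMap.ker (normBdry X n)

theorem mem_cycles_zero (X : SimplicialObject (ModuleCat.{w} k)) (x : Norm X 0) :
    x ∈ cycles X 0 :=
  Submodule.mem_top

/-- Boundaries of the normalized complex. -/
def boundaries (X : SimplicialObject (ModuleCat.{w} k)) (n : ℕ) : Submodule k (Norm X n) :=
  LinearMap.range (normBdry X n)

/-- The `n`-th homology of the normalized complex of a simplicial module. -/
abbrev Homology (X : SimplicialObject (ModuleCat.{w} k)) (n : ℕ) : Type w :=
  cycles X n ⧸ (boundaries X n).submoduleOf (cycles X n)

/-- The homology class of a `0`-simplex. -/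
def zeroClass (X : SimplicialObject (ModuleCat.{w} k)) : Deg X 0 →ₗ[k] Homology X 0 :=
  (Submodule.mkQ _).comp ((LinearMap.codRestrict (cycles X 0) LinearMap.id
    (mem_cycles_zero X)).comp (Submodule.mkQ _))

section map
variable {X Y : SimplicialObject (ModuleCat.{w} k)} (f : X ⟶ Y)

abbrev degMap (n : ℕ) : Deg X n →ₗ[k] Deg Y n := (f.app (op (SimplexCategory.mk n))).hom

theorem degMap_face (n i x) : degMap f n (face X n i x) = face Y n i (degMap f (n + 1) x) :=
  (congrArg (fun g => g.hom x) (f.naturality (SimplexCategory.δ i).op)) 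

theorem degMap_degen (n i x) : degMap f (n + 1) (degen X n i x) = degen Y n i (degMap f n x) :=
  (congrArg (fun g => g.hom x) (f.naturality (SimplexCategory.σ i).op)) 

theorem degMap_degenerate : ∀ n, degenerate (degen X) n ≤ (degenerate (degen Y) n).comap (degMap f n)
  | 0 => bot_le
  | n + 1 => degenerate_le _ _ fun i x => by
      rw [Submodule.mem_comap, degMap_degen]
      exact s_mem_degenerate (A := Deg Y) _ _ _

theorem degMap_bdry (n x) : degMap f n (bdry (face X) n x) = bdry (face Y) n (degMap f (n + 1) x) := by
  simp only [bdry, LinearMap.sum_apply, map_sum, LinearMap.smul_apply, map_smul, degMap_face]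

def normMap (n : ℕ) : Norm X n →ₗ[k] Norm Y n := Submodule.mapQ _ _ (degMap f n) (degMap_degenerate f n)

theorem normMap_bdry (n x) : normMap f n (normBdry X n x) = normBdry Y n (normMap f (n + 1) x) := by
  obtain ⟨x, rfl⟩ := Submodule.mkQ_surjective _ x
  exact congrArg (Submodule.mkQ _) (degMap_bdry f n x)

theorem normMap_cycles : ∀ n, ∀ x ∈ cycles X n, normMap f n x ∈ cycles Y n
  | 0, _, _ => Submodule.mem_top
  | n + 1, x, hx => by
      have hx' : normBdry X n x = 0 := hx
      change normBdry Y n _ = 0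
      rw [← normMap_bdry, hx', map_zero]

/-- The map induced in homology by a map of simplicial modules. -/
def homologyMap (n : ℕ) : Homology X n →ₗ[k] Homology Y n :=
  Submodule.mapQ _ _ ((normMap f n).restrict (normMap_cycles f n)) (by
    rintro ⟨_, hx⟩ ⟨z, rfl⟩
    exact ⟨normMap f (n + 1) z, (normMap_bdry f n z).symm⟩)
end map

/-- The degreewise tensor product of simplicial modules. -/
noncomputable def tens (X : SimplicialObject (ModuleCat.{w₁} k)) (Y : SimplicialObject (ModuleCat.{w₂} k)) :
    SimplicialObject (ModuleCat.{max w₁ w₂} k) where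
  obj Δ := ModuleCat.of k (X.obj Δ ⊗[k] Y.obj Δ)
  map f := ModuleCat.ofHom (TensorProduct.map (X.map f).hom (Y.map f).hom)
  map_id Δ := by
    ext : 1
    simp 
  map_comp f g := by
    ext : 1
    simp [TensorProduct.map_comp]

end Homology

section Cross
variable {k : Type u} [CommRing k]

/-- The bilinear map induced on quotients by a bilinear map. -/
def quotBilin {M : Type w} {N : Type w₁} {P : Type w₂} [AddCommGroup M] [Module k M]
    [AddCommGroup N] [Module k N] [AddCommGroup P] [Module k P]
    (M' : Submodule k M) (N' : Submodule k N) (P' : Submodule k P) (f : M →ₗ[k] N →ₗ[k] P)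
    (h₁ : ∀ x ∈ M', ∀ y, f x y ∈ P') (h₂ : ∀ x, ∀ y ∈ N', f x y ∈ P') :
    (M ⧸ M') →ₗ[k] (N ⧸ N') →ₗ[k] (P ⧸ P') :=
  M'.liftQ
    { toFun := fun x => N'.mapQ P' (f x) (h₂ x)
      map_add' := fun x x' => by
        ext y
        simp
      map_smul' := fun c x => by
        ext y
        simp }
    (fun x hx => by
      rw [LinearMap.mem_ker]
      ext y
      simpa using h₁ x hx y)

/-- The bilinear map induced on submodules by a bilinear map. -/
def restrictBilin {M : Type w} {N : Type w₁} {P : Type w₂} [AddCommGroup M] [Module k M]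
    [AddCommGroup N] [Module k N] [AddCommGroup P] [Module k P]
    (M' : Submodule k M) (N' : Submodule k N) (P' : Submodule k P) (f : M →ₗ[k] N →ₗ[k] P)
    (h : ∀ x ∈ M', ∀ y ∈ N', f x y ∈ P') : M' →ₗ[k] N' →ₗ[k] P' :=
  LinearMap.mk₂ k (fun x y => ⟨f x y, h x x.2 y y.2⟩)
    (fun _ _ _ => by ext; simp) (fun _ _ _ => by ext; simp)
    (fun _ _ _ => by ext; simp) (fun _ _ _ => by ext; simp)

variable (X : SimplicialObject (ModuleCat.{w₁} k)) (Y : SimplicialObject (ModuleCat.{w₂} k))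

/-- The shuffle map of two simplicial modules. -/
noncomputable def degShuffle (p q n : ℕ) (h : p + q = n) :
    Deg X p →ₗ[k] Deg Y q →ₗ[k] Deg (tens X Y) n :=
  shuffle n (degen X) (degen Y) p q h

theorem degShuffle_left (p q n : ℕ) (h : p + q = n) (x : Deg X p)
    (hx : x ∈ degenerate (degen X) p) (y : Deg Y q) :
    degShuffle X Y p q n h x y ∈ degenerate (degen (tens X Y)) n := by
  cases p with
  | zero => rw [show x = 0 from hx]; simp
  | succ p =>
    exact degenerate_le p ((degenerate (degen (tens X Y)) n).comap
      ((degShuffle X Y (p + 1) q n h).flip y))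
      (fun i x => (shuffle_degenerate n (isSimp X) (isSimp Y)).1 p q h i x y) hx

theorem degShuffle_right (p q n : ℕ) (h : p + q = n) (x : Deg X p) (y : Deg Y q)
    (hy : y ∈ degenerate (degen Y) q) :
    degShuffle X Y p q n h x y ∈ degenerate (degen (tens X Y)) n := by
  cases q with
  | zero => rw [show y = 0 from hy]; simp
  | succ q =>
    exact degenerate_le q ((degenerate (degen (tens X Y)) n).comap
      (degShuffle X Y p (q + 1) n h x))
      (fun i y => (shuffle_degenerate n (isSimp X) (isSimp Y)).2 p q h i x y) hy

/-- The shuffle map on normalized complexes. -/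
noncomputable def normShuffle (p q n : ℕ) (h : p + q = n) :
    Norm X p →ₗ[k] Norm Y q →ₗ[k] Norm (tens X Y) n :=
  quotBilin _ _ _ (degShuffle X Y p q n h)
    (fun x hx y => degShuffle_left X Y p q n h x hx y)
    (fun x y hy => degShuffle_right X Y p q n h x y hy)

theorem normShuffle_left (p n : ℕ) (h : p + 1 + 0 = n + 1) (x : Norm X (p + 1)) (y : Norm Y 0) :
    normBdry (tens X Y) n (normShuffle X Y (p + 1) 0 (n + 1) h x y) =
      normShuffle X Y p 0 n (by omega) (normBdry X p x) y := by
  obtain ⟨x, rfl⟩ := Submodule.mkQ_surjective _ x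
  obtain ⟨y, rfl⟩ := Submodule.mkQ_surjective _ y
  exact congrArg (Submodule.mkQ _) ((shuffle_leibniz n (isSimp X) (isSimp Y)).1 p h x y)

theorem normShuffle_right (q n : ℕ) (h : 0 + (q + 1) = n + 1) (x : Norm X 0) (y : Norm Y (q + 1)) :
    normBdry (tens X Y) n (normShuffle X Y 0 (q + 1) (n + 1) h x y) =
      normShuffle X Y 0 q n (by omega) x (normBdry Y q y) := by
  obtain ⟨x, rfl⟩ := Submodule.mkQ_surjective _ x
  obtain ⟨y, rfl⟩ := Submodule.mkQ_surjective _ y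
  exact congrArg (Submodule.mkQ _) ((shuffle_leibniz n (isSimp X) (isSimp Y)).2.1 q h x y)

theorem normShuffle_both (p q n : ℕ) (h : p + 1 + (q + 1) = n + 1) (x : Norm X (p + 1))
    (y : Norm Y (q + 1)) :
    normBdry (tens X Y) n (normShuffle X Y (p + 1) (q + 1) (n + 1) h x y) =
      normShuffle X Y p (q + 1) n (by omega) (normBdry X p x) y +
      (-1 : k) ^ (p + 1) • normShuffle X Y (p + 1) q n (by omega) x (normBdry Y q y) := by
  obtain ⟨x, rfl⟩ := Submodule.mkQ_surjective _ x
  obtain ⟨y, rfl⟩ := Submodule.mkQ_surjective _ y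
  exact congrArg (Submodule.mkQ _) ((shuffle_leibniz n (isSimp X) (isSimp Y)).2.2 p q h x y)

theorem normShuffle_cycles (p q n : ℕ) (h : p + q = n) (x : Norm X p) (hx : x ∈ cycles X p)
    (y : Norm Y q) (hy : y ∈ cycles Y q) : normShuffle X Y p q n h x y ∈ cycles (tens X Y) n := by
  match p, q, n, h, x, hx, y, hy with
  | _, _, 0, _, _, _, _, _ => exact Submodule.mem_top
  | 0, 0, n + 1, h, _, _, _, _ => omega
  | p + 1, 0, n + 1, h, x, hx, y, hy =>
    have hx' : normBdry X p x = 0 := hx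
    change normBdry _ _ _ = 0
    rw [normShuffle_left, hx', map_zero, LinearMap.zero_apply]
  | 0, q + 1, n + 1, h, x, hx, y, hy =>
    have hy' : normBdry Y q y = 0 := hy
    change normBdry _ _ _ = 0
    rw [normShuffle_right, hy', map_zero]
  | p + 1, q + 1, n + 1, h, x, hx, y, hy =>
    have hx' : normBdry X p x = 0 := hx
    have hy' : normBdry Y q y = 0 := hy
    change normBdry _ _ _ = 0
    rw [normShuffle_both, hx', hy', map_zero, map_zero, LinearMap.zero_apply, smul_zero, add_zero]

theorem normShuffle_bdry_left (p q n : ℕ) (h : p + q = n) (x : Norm X (p + 1))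
    (y : Norm Y q) (hy : y ∈ cycles Y q) :
    normShuffle X Y p q n h (normBdry X p x) y ∈ boundaries (tens X Y) n := by
  refine ⟨normShuffle X Y (p + 1) q (n + 1) (by omega) x y, ?_⟩
  cases q with
  | zero => rw [normShuffle_left]
  | succ q =>
    have hy' : normBdry Y q y = 0 := hy
    rw [normShuffle_both, hy', map_zero, smul_zero, add_zero]

theorem normShuffle_bdry_right (p q n : ℕ) (h : p + q = n) (x : Norm X p) (hx : x ∈ cycles X p)
    (y : Norm Y (q + 1)) :
    normShuffle X Y p q n h x (normBdry Y q y) ∈ boundaries (tens X Y) n := by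
  refine ⟨(-1 : k) ^ p • normShuffle X Y p (q + 1) (n + 1) (by omega) x y, ?_⟩
  cases p with
  | zero => rw [map_smul, normShuffle_right]; simp
  | succ p =>
    have hx' : normBdry X p x = 0 := hx
    rw [map_smul, normShuffle_both, hx', map_zero, LinearMap.zero_apply, zero_add, smul_smul,
      ← mul_pow]
    simp

/-- The homology cross product `[x] ⊗ [y] ↦ [Sh (x ⊗ y)]`. -/
noncomputable def homologyCross (p q n : ℕ) (h : p + q = n) :
    Homology X p →ₗ[k] Homology Y q →ₗ[k] Homology (tens X Y) n :=
  quotBilin _ _ _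
    (restrictBilin (cycles X p) (cycles Y q) (cycles (tens X Y) n) (normShuffle X Y p q n h)
      (fun x hx y hy => normShuffle_cycles X Y p q n h x hx y hy))
    (by
      rintro ⟨_, hx⟩ ⟨x, rfl⟩ ⟨y, hy⟩
      exact normShuffle_bdry_left X Y p q n h x y hy)
    (by
      rintro ⟨x, hx⟩ ⟨_, hy⟩ ⟨y, rfl⟩
      exact normShuffle_bdry_right X Y p q n h x hx y)
end Cross

/-! ### Non-commutative sets -/

/-- A morphism of non-commutative sets: a map together with a total order on each of its fibres,
written as the list of the elements of the fibre in increasing order. -/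
@[ext]
structure NCMap (X Y : Type) where
  toFun : X → Y
  fib : Y → List X
  nodup_fib : ∀ y, (fib y).Nodup
  mem_fib : ∀ x y, x ∈ fib y ↔ toFun x = y

namespace NCMap
variable {X Y Z X' Y' Z' : Type}

theorem ext' {f g : NCMap X Y} (h : ∀ y, f.fib y = g.fib y) : f = g := by
  have h1 : f.fib = g.fib := funext h
  refine NCMap.ext (funext fun x => ?_) h1
  exact ((g.mem_fib x _).1 (h1 ▸ (f.mem_fib x _).2 rfl)).symm

/-- A bijection, with its one-element fibres. -/
def ofEquiv (e : X ≃ Y) : NCMap X Y where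
  toFun := e
  fib y := [e.symm y]
  nodup_fib y := List.nodup_singleton _
  mem_fib x y := by rw [List.mem_singleton, Equiv.eq_symm_apply]

/-- Composition: the fibre over `z` is ordered lexicographically, first by the order of the fibre of
`g` over `z`, then by the orders of the fibres of `f`. -/
def comp (f : NCMap X Y) (g : NCMap Y Z) : NCMap X Z where
  toFun := g.toFun ∘ f.toFun
  fib z := (g.fib z).flatMap f.fib
  nodup_fib z := by
    rw [List.nodup_flatMap]
    refine ⟨fun y _ => f.nodup_fib y, (g.nodup_fib z).imp fun {a b} hab => ?_⟩
    intro x hx hx'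
    exact hab (((f.mem_fib x a).1 hx).symm.trans ((f.mem_fib x b).1 hx'))
  mem_fib x z := by simp [List.mem_flatMap, f.mem_fib, g.mem_fib]

/-- Disjoint union of morphisms. -/
def sum (f : NCMap X Y) (g : NCMap X' Y') : NCMap (X ⊕ X') (Y ⊕ Y') where
  toFun := Sum.map f.toFun g.toFun
  fib := Sum.elim (fun y => (f.fib y).map Sum.inl) (fun y => (g.fib y).map Sum.inr)
  nodup_fib := by
    rintro (y | y)
    · exact (f.nodup_fib y).map Sum.inl_injective
    · exact (g.nodup_fib y).map Sum.inr_injective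
  mem_fib := by
    rintro (x | x) (y | y) <;> simp [f.mem_fib, g.mem_fib]

theorem comp_assoc {W : Type} (f : NCMap X Y) (g : NCMap Y Z) (h : NCMap Z W) :
    (f.comp g).comp h = f.comp (g.comp h) :=
  ext' fun w => by simp [comp, List.flatMap_assoc]

theorem refl_comp (f : NCMap X Y) : (ofEquiv (Equiv.refl X)).comp f = f :=
  ext' fun y => by simp [comp, ofEquiv]

theorem comp_refl (f : NCMap X Y) : f.comp (ofEquiv (Equiv.refl Y)) = f :=
  ext' fun y => by simp [comp, ofEquiv]

theorem ofEquiv_trans (e : X ≃ Y) (e' : Y ≃ Z) :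
    (ofEquiv e).comp (ofEquiv e') = ofEquiv (e.trans e') :=
  ext' fun y => by simp [comp, ofEquiv]

theorem ofEquiv_symm_comp (e : X ≃ Y) (f : NCMap X Z) :
    (ofEquiv e).comp ((ofEquiv e.symm).comp f) = f := by
  rw [← comp_assoc, ofEquiv_trans, Equiv.self_trans_symm, refl_comp]

theorem sum_refl : (ofEquiv (Equiv.refl X)).sum (ofEquiv (Equiv.refl Y)) =
    ofEquiv (Equiv.refl (X ⊕ Y)) :=
  ext' fun y => by rcases y with y | y <;> simp [sum, ofEquiv]

theorem sum_comp (f : NCMap X Y) (g : NCMap Y Z) (f' : NCMap X' Y') (g' : NCMap Y' Z') :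
    (f.comp g).sum (f'.comp g') = (f.sum f').comp (g.sum g') :=
  ext' fun y => by
    rcases y with y | y <;> simp [sum, comp, List.map_flatMap, List.flatMap_map]

end NCMap

/-- The objects `0, 1, 2, …` of the category of non-commutative sets, which is `ΔS₊`: the object
`[m - 1]` of `ΔS₊` is the set with `m` elements, and the empty set is the initial object. -/
structure NCSet where
  card : ℕ

instance : Category NCSet where
  Hom m n := NCMap (Fin m.card) (Fin n.card)
  id m := NCMap.ofEquiv (Equiv.refl _)
  comp f g := NCMap.comp f g
  id_comp f := NCMap.refl_comp f
  comp_id f := NCMap.comp_refl f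
  assoc f g h := NCMap.comp_assoc f g h

namespace NCSet

/-- The monoidal product `m ⊙ n` on objects. -/
abbrev prod (m n : NCSet) : NCSet := ⟨m.card + n.card⟩

/-- The monoidal product `f ⊙ g` on morphisms. -/
def prodMap {m m' n n' : NCSet} (f : m ⟶ m') (g : n ⟶ n') : prod m n ⟶ prod m' n' :=
  ((NCMap.ofEquiv finSumFinEquiv.symm).comp (NCMap.sum f g)).comp (NCMap.ofEquiv finSumFinEquiv)

/-- The disjoint union of two blocks as an ordered set, with the blocks exchanged. -/
def swapEquiv (p q : ℕ) : Fin p ⊕ Fin q ≃ Fin (p + q) :=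
  (Equiv.sumComm _ _).trans (finSumFinEquiv.trans (finCongr (Nat.add_comm q p)))

/-- The disjoint union of two blocks as an ordered set, with the blocks in the order given by `σ`. -/
def blockEquiv (σ : Equiv.Perm (Fin 2)) (p q : ℕ) : Fin p ⊕ Fin q ≃ Fin (p + q) :=
  if σ = 1 then finSumFinEquiv else swapEquiv p q

/-- The block permutation `σ{p, q}`. -/
def blockPerm (σ : Equiv.Perm (Fin 2)) (p q : NCSet) : prod p q ⟶ prod p q :=
  NCMap.ofEquiv (finSumFinEquiv.symm.trans (blockEquiv σ p.card q.card))


theorem blockPerm_one (p q : NCSet) : blockPerm 1 p q = 𝟙 _ := by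
  simp [blockPerm, blockEquiv]
  rfl

theorem prodMap_id (p q : NCSet) : prodMap (𝟙 p) (𝟙 q) = 𝟙 (prod p q) := by
  change ((NCMap.ofEquiv finSumFinEquiv.symm).comp (NCMap.sum (NCMap.ofEquiv (Equiv.refl _))
    (NCMap.ofEquiv (Equiv.refl _)))).comp (NCMap.ofEquiv finSumFinEquiv) = NCMap.ofEquiv _
  rw [NCMap.sum_refl, NCMap.comp_refl, NCMap.ofEquiv_trans, Equiv.symm_trans_self]

theorem prodMap_comp {m m' m'' n n' n'' : NCSet} (f : m ⟶ m') (f' : m' ⟶ m'') (g : n ⟶ n')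
    (g' : n' ⟶ n'') : prodMap (f ≫ f') (g ≫ g') = prodMap f g ≫ prodMap f' g' := by
  change ((NCMap.ofEquiv finSumFinEquiv.symm).comp (NCMap.sum (NCMap.comp f f')
    (NCMap.comp g g'))).comp (NCMap.ofEquiv finSumFinEquiv) =
    NCMap.comp (((NCMap.ofEquiv finSumFinEquiv.symm).comp (NCMap.sum f g)).comp
      (NCMap.ofEquiv finSumFinEquiv)) (((NCMap.ofEquiv finSumFinEquiv.symm).comp
      (NCMap.sum f' g')).comp (NCMap.ofEquiv finSumFinEquiv))
  rw [NCMap.sum_comp]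
  simp only [NCMap.comp_assoc, NCMap.ofEquiv_symm_comp]

/-- The inverse of the block permutation `σ{p, q}`. -/
def blockPermInv (σ : Equiv.Perm (Fin 2)) (p q : NCSet) : prod p q ⟶ prod p q :=
  NCMap.ofEquiv (finSumFinEquiv.symm.trans (blockEquiv σ p.card q.card)).symm

@[simp]
theorem blockPerm_inv (σ : Equiv.Perm (Fin 2)) (p q : NCSet) :
    blockPerm σ p q ≫ blockPermInv σ p q = 𝟙 _ := by
  change NCMap.comp (NCMap.ofEquiv _) (NCMap.ofEquiv _) = NCMap.ofEquiv _
  rw [NCMap.ofEquiv_trans, Equiv.self_trans_symm]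

@[simp]
theorem blockPerm_inv_assoc (σ : Equiv.Perm (Fin 2)) (p q : NCSet) {r : NCSet}
    (f : prod p q ⟶ r) : blockPerm σ p q ≫ blockPermInv σ p q ≫ f = f := by
  rw [← Category.assoc, blockPerm_inv, Category.id_comp]

@[simp]
theorem blockPermInv_blockPerm (σ : Equiv.Perm (Fin 2)) (p q : NCSet) :
    blockPermInv σ p q ≫ blockPerm σ p q = 𝟙 _ := by
  change NCMap.comp (NCMap.ofEquiv _) (NCMap.ofEquiv _) = NCMap.ofEquiv _
  rw [NCMap.ofEquiv_trans, Equiv.symm_trans_self]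

end NCSet

open NCSet

/-- The category `ES₂` (arity two of the Barratt-Eccles operad in categories): its objects are the
elements of the symmetric group `S₂`, with exactly one morphism between any two of them. -/
abbrev D2 : Type := Codiscrete (Equiv.Perm (Fin 2))

/-- The under-category `m \ ΔS₊`. -/
abbrev K (m : NCSet) : Type := Under m

/-- The operad-module structure functor `μ : ES₂ × (m \ ΔS₊) × (n \ ΔS₊) → (m ⊙ n) \ ΔS₊`. On objects
it is `(σ, f₁, f₂) ↦ σ{p₁, p₂} (f₁ ⊙ f₂)`, and a morphism `(σ → τ, g₁, g₂)` goes to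
`τ{q₁, q₂} (g₁ ⊙ g₂) σ{p₁, p₂}⁻¹`. -/
def mu (m n : NCSet) : D2 × (K m × K n) ⥤ K (NCSet.prod m n) where
  obj X := Under.mk (prodMap X.2.1.hom X.2.2.hom ≫ blockPerm X.1.as X.2.1.right X.2.2.right)
  map {X Y} f := Under.homMk (blockPermInv X.1.as X.2.1.right X.2.2.right ≫
    prodMap f.2.1.right f.2.2.right ≫ blockPerm Y.1.as Y.2.1.right Y.2.2.right) (by
      have h1 : X.2.1.hom ≫ f.2.1.right = Y.2.1.hom := Under.w f.2.1
      have h2 : X.2.2.hom ≫ f.2.2.right = Y.2.2.hom := Under.w f.2.2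
      simp only [Under.mk_hom, Under.mk_right, Category.assoc, blockPerm_inv_assoc]
      rw [← h1, ← h2, prodMap_comp, Category.assoc])
  map_id X := by
    ext1
    simp [prodMap_id]
  map_comp f g := by
    ext1
    simp [prodMap_comp]

theorem functor_under_ext {C : Type} [Category.{0} C] {X : NCSet} {F G : C ⥤ Under X}
    (h : ∀ c, F.obj c = G.obj c)
    (h' : ∀ {c c' : C} (f : c ⟶ c'), (F.map f).right =
      eqToHom (congrArg (fun Z : Under X => Z.right) (h c)) ≫ (G.map f).right ≫
        eqToHom (congrArg (fun Z : Under X => Z.right) (h c').symm)) : F = G := by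
  refine CategoryTheory.Functor.ext h fun c c' f => ?_
  ext1
  simpa [Under.eqToHom_right] using h' f

theorem mu_left {C : Type} [Category.{0} C] {m m' n : NCSet} (h : m ⟶ m') (d : C ⥤ D2)
    (s : C ⥤ K m') (t : C ⥤ K n) :
    (d.prod' ((s ⋙ Under.map h).prod' t)) ⋙ mu m n =
      ((d.prod' (s.prod' t)) ⋙ mu m' n) ⋙ Under.map (prodMap h (𝟙 n)) := by
  refine functor_under_ext (fun c => ?_) (fun f => ?_)
  · have h1 : prodMap (h ≫ (s.obj c).hom) (t.obj c).hom =
        prodMap h (𝟙 n) ≫ prodMap (s.obj c).hom (t.obj c).hom := by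
      rw [← prodMap_comp, Category.id_comp]
    exact congrArg Under.mk ((congrArg (fun g => g ≫ blockPerm _ _ _) h1).trans
      (Category.assoc _ _ _))
  · exact ((Category.id_comp _).trans (Category.comp_id _)).symm

theorem mu_right {C : Type} [Category.{0} C] {m n n' : NCSet} (h : n ⟶ n') (d : C ⥤ D2)
    (s : C ⥤ K m) (t : C ⥤ K n') :
    (d.prod' (s.prod' (t ⋙ Under.map h))) ⋙ mu m n =
      ((d.prod' (s.prod' t)) ⋙ mu m n') ⋙ Under.map (prodMap (𝟙 m) h) := by
  refine functor_under_ext (fun c => ?_) (fun f => ?_)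
  · have h1 : prodMap (s.obj c).hom (h ≫ (t.obj c).hom) =
        prodMap (𝟙 m) h ≫ prodMap (s.obj c).hom (t.obj c).hom := by
      rw [← prodMap_comp, Category.id_comp]
    exact congrArg Under.mk ((congrArg (fun g => g ≫ blockPerm _ _ _) h1).trans
      (Category.assoc _ _ _))
  · exact ((Category.id_comp _).trans (Category.comp_id _)).symm

/-! ### The symmetric bar construction -/
section Bar
variable (k : Type u) [CommRing k] (A : Type v) [Ring A] [Algebra k A]

theorem prod_map_update {X : Type} [DecidableEq X] (a : X → A) (i : X) (c : A)
    {l : List X} (hl : l.Nodup) (hi : i ∈ l) : ∃ P Q : A, ∀ c : A,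
      (l.map (Function.update a i c)).prod = P * c * Q := by
  obtain ⟨l₁, l₂, rfl⟩ := List.append_of_mem hi
  refine ⟨(l₁.map a).prod, (l₂.map a).prod, fun c => ?_⟩
  have h := List.nodup_append.1 hl
  have h1 : i ∉ l₁ := fun h' => h.2.2 i h' i (by simp) rfl
  have h2 : i ∉ l₂ := (List.nodup_cons.1 h.2.1).1
  have e : ∀ l : List X, i ∉ l → l.map (Function.update a i c) = l.map a := fun l hl =>
    List.map_congr_left fun x hx => Function.update_of_ne (by rintro rfl; exact hl hx) _ _
  simp [e l₁ h1, e l₂ h2, mul_assoc]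

theorem fib_update {X Y : Type} [DecidableEq X] [DecidableEq Y] (f : NCMap X Y) (a : X → A)
    (i : X) : ∃ P Q : A, ∀ c : A,
      (fun y => ((f.fib y).map (Function.update a i c)).prod) =
        Function.update (fun y => ((f.fib y).map a).prod) (f.toFun i) (P * c * Q) := by
  obtain ⟨P, Q, h⟩ := prod_map_update A a i 0 (f.nodup_fib _) ((f.mem_fib i _).2 rfl)
  refine ⟨P, Q, fun c => funext fun y => ?_⟩
  by_cases hy : y = f.toFun i
  · subst hy
    rw [h c, Function.update_self]
  · rw [Function.update_of_ne hy]
    congr 1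
    refine List.map_congr_left fun x hx => Function.update_of_ne ?_ _ _
    rintro rfl
    exact hy ((f.mem_fib _ _).1 hx).symm

/-- The multilinear map behind `bar`. -/
noncomputable def barMultilinear {X Y : Type} [DecidableEq Y] (f : NCMap X Y) :
    MultilinearMap k (fun _ : X => A) (⨂[k] _ : Y, A) where
  toFun a := PiTensorProduct.tprod k (fun y => ((f.fib y).map a).prod)
  map_update_add' {_} a i x y := by
    obtain ⟨P, Q, h⟩ := fib_update A f a i
    rw [h, h, h, mul_add, add_mul, MultilinearMap.map_update_add]
  map_update_smul' {_} a i c x := by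
    obtain ⟨P, Q, h⟩ := fib_update A f a i
    rw [h, h, mul_smul_comm, smul_mul_assoc, MultilinearMap.map_update_smul]

/-- The symmetric bar construction on morphisms: the object with `m` elements goes to `A^{⊗m}`, and `f`
acts by `a ↦ ⨂_y ∏_{x ∈ f⁻¹(y)} a_x`, the product in the order of the fibre. -/
noncomputable def bar {m n : ℕ} (f : (⟨m⟩ : NCSet) ⟶ ⟨n⟩) :
    (⨂[k] _ : Fin m, A) →ₗ[k] (⨂[k] _ : Fin n, A) :=
  PiTensorProduct.lift (barMultilinear k A f)

theorem bar_tprod {m n : ℕ} (f : (⟨m⟩ : NCSet) ⟶ ⟨n⟩) (a : Fin m → A) :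
    bar k A f (PiTensorProduct.tprod k a) =
      PiTensorProduct.tprod k (fun y => ((NCMap.fib f y).map a).prod) :=
  PiTensorProduct.lift.tprod a

theorem bar_id (m : ℕ) : bar k A (𝟙 (⟨m⟩ : NCSet)) = LinearMap.id := by
  refine PiTensorProduct.ext (MultilinearMap.ext fun a => ?_)
  refine (bar_tprod k A _ a).trans ?_
  refine congrArg (PiTensorProduct.tprod k) (funext fun y => ?_)
  change ([y].map a).prod = a y
  simp

theorem bar_comp {m n p : ℕ} (f : (⟨m⟩ : NCSet) ⟶ ⟨n⟩) (g : (⟨n⟩ : NCSet) ⟶ ⟨p⟩) :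
    bar k A (f ≫ g) = (bar k A g).comp (bar k A f) := by
  refine PiTensorProduct.ext (MultilinearMap.ext fun a => ?_)
  simp only [LinearMap.compMultilinearMap_apply, LinearMap.comp_apply, bar_tprod]
  refine congrArg (PiTensorProduct.tprod k) (funext fun y => ?_)
  change (((NCMap.fib g y).flatMap (NCMap.fib f)).map a).prod = _
  rw [List.map_flatMap, List.flatMap_def, List.prod_flatten, List.map_map]
  rfl

/-- The canonical isomorphism `A^{⊗m} ⊗ A^{⊗n} → A^{⊗(m+n)}`. -/
noncomputable def juxt (m n : ℕ) :
    ((⨂[k] _ : Fin m, A) ⊗[k] (⨂[k] _ : Fin n, A)) →ₗ[k] (⨂[k] _ : Fin (m + n), A) :=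
  ((PiTensorProduct.tmulEquiv k A (ι := Fin m) (ι₂ := Fin n)).trans
    (PiTensorProduct.reindex k (fun _ => A) finSumFinEquiv)).toLinearMap

theorem juxt_tprod (m n : ℕ) (a : Fin m → A) (b : Fin n → A) :
    juxt k A m n (PiTensorProduct.tprod k a ⊗ₜ PiTensorProduct.tprod k b) =
      PiTensorProduct.tprod k (fun i => Sum.elim a b (finSumFinEquiv.symm i)) := by
  simp [juxt]

theorem bar_juxt {m m' n n' : ℕ} (f : (⟨m⟩ : NCSet) ⟶ ⟨m'⟩) (g : (⟨n⟩ : NCSet) ⟶ ⟨n'⟩) :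
    (bar k A (prodMap f g)).comp (juxt k A m n) =
      (juxt k A m' n').comp (TensorProduct.map (bar k A f) (bar k A g)) := by
  refine TensorProduct.ext (PiTensorProduct.ext (MultilinearMap.ext fun a =>
    PiTensorProduct.ext (MultilinearMap.ext fun b => ?_)))
  change bar k A (prodMap f g) (juxt k A m n (PiTensorProduct.tprod k a ⊗ₜ
    PiTensorProduct.tprod k b)) = juxt k A m' n' (bar k A f (PiTensorProduct.tprod k a) ⊗ₜ
      bar k A g (PiTensorProduct.tprod k b))
  rw [bar_tprod, bar_tprod, juxt_tprod, juxt_tprod, bar_tprod]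
  refine congrArg (PiTensorProduct.tprod k) (funext fun y => ?_)
  obtain ⟨y, rfl⟩ := finSumFinEquiv.surjective y
  rcases y with y | y <;>
    simp [prodMap, NCMap.comp, NCMap.ofEquiv, NCMap.sum, List.flatMap_map,
      ← List.map_eq_flatMap, Function.comp_def]


/-! ### The simplicial module `𝒴₊(A) = k[N(- \ ΔS₊)] ⊗_{ΔS₊} B(A)`

Here `B(A)` is the symmetric bar construction. The tensor product over `ΔS₊` is the direct sum over
all objects `m` of `k[N(m \ ΔS₊)] ⊗ A^{⊗m}`, modulo `h^*(s) ⊗ v = s ⊗ h_*(v)`. -/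

/-- The simplices of the nerve of `m \ ΔS₊`. -/
abbrev Chains (m : ℕ) (Δ : SimplexCategoryᵒᵖ) : Type := (nerve (K ⟨m⟩)).obj Δ

/-- The direct sum of all `k[N(m \ ΔS₊)] ⊗ A^{⊗m}`. -/
noncomputable abbrev Pre (Δ : SimplexCategoryᵒᵖ) : Type (max u v) :=
  DirectSum ℕ fun m => (Chains m Δ →₀ k) ⊗[k] (⨂[k] _ : Fin m, A)

noncomputable instance (Δ : SimplexCategoryᵒᵖ) : AddCommGroup (Pre k A Δ) :=
  Module.addCommMonoidToAddCommGroup k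

/-- The generator `s ⊗ v` of the summand with index `m`. -/
noncomputable def gen {Δ : SimplexCategoryᵒᵖ} (m : ℕ) (s : Chains m Δ) (v : ⨂[k] _ : Fin m, A) :
    Pre k A Δ :=
  DirectSum.lof k ℕ (fun m => (Chains m Δ →₀ k) ⊗[k] (⨂[k] _ : Fin m, A)) m
    (Finsupp.single s 1 ⊗ₜ v)

/-- The contravariant action of a morphism `h` of `ΔS₊` on the nerves of the under-categories. -/
def pull {Δ : SimplexCategoryᵒᵖ} {m n : ℕ} (h : (⟨m⟩ : NCSet) ⟶ ⟨n⟩) (s : Chains n Δ) :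
    Chains m Δ :=
  (nerveMap (Under.map h)).app Δ s

/-- The relations `h^*(s) ⊗ v = s ⊗ h_*(v)`. -/
noncomputable def rel (Δ : SimplexCategoryᵒᵖ) : Submodule k (Pre k A Δ) :=
  Submodule.span k {z | ∃ (m n : ℕ) (h : (⟨m⟩ : NCSet) ⟶ ⟨n⟩) (s : Chains n Δ)
    (v : ⨂[k] _ : Fin m, A), z = gen k A m (pull h s) v - gen k A n s (bar k A h v)}

/-- The simplicial structure, which comes from that of the nerves. -/
noncomputable def preMap {Δ Δ' : SimplexCategoryᵒᵖ} (α : Δ ⟶ Δ') : Pre k A Δ →ₗ[k] Pre k A Δ' :=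
  DirectSum.lmap fun m => TensorProduct.map
    (Finsupp.lmapDomain k k ((nerve (K ⟨m⟩)).map α)) LinearMap.id

theorem preMap_gen {Δ Δ' : SimplexCategoryᵒᵖ} (α : Δ ⟶ Δ') (m : ℕ) (s : Chains m Δ)
    (v : ⨂[k] _ : Fin m, A) :
    preMap k A α (gen k A m s v) = gen k A m ((nerve (K ⟨m⟩)).map α s) v := by
  simp [preMap, gen, DirectSum.lmap_lof]

theorem pre_ext {Δ : SimplexCategoryᵒᵖ} {M : Type*} [AddCommGroup M] [Module k M]
    {f g : Pre k A Δ →ₗ[k] M} (h : ∀ m s v, f (gen k A m s v) = g (gen k A m s v)) : f = g := by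
  refine DirectSum.linearMap_ext k fun m => TensorProduct.ext (Finsupp.lhom_ext' fun s =>
    LinearMap.ext_ring (LinearMap.ext fun v => h m s v))

theorem preMap_rel {Δ Δ' : SimplexCategoryᵒᵖ} (α : Δ ⟶ Δ') :
    rel k A Δ ≤ (rel k A Δ').comap (preMap k A α) := by
  refine Submodule.span_le.2 ?_
  rintro _ ⟨m, n, h, s, v, rfl⟩
  refine Submodule.subset_span ⟨m, n, h, (nerve (K ⟨n⟩)).map α s, v, ?_⟩
  rw [map_sub, preMap_gen, preMap_gen]
  rfl

/-- The simplicial `k`-module `k[N(- \ ΔS₊)] ⊗_{ΔS₊} B(A)`. -/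
noncomputable def Y : SimplicialObject (ModuleCat.{max u v} k) where
  obj Δ := ModuleCat.of k (Pre k A Δ ⧸ rel k A Δ)
  map α := ModuleCat.ofHom (Submodule.mapQ _ _ (preMap k A α) (preMap_rel k A α))
  map_id Δ := by
    ext1
    refine Submodule.linearMap_qext _ (pre_ext k A fun m s v => ?_)
    exact congrArg (Submodule.mkQ _) (preMap_gen k A (𝟙 Δ) m s v)
  map_comp α β := by
    ext1
    refine Submodule.linearMap_qext _ (pre_ext k A fun m s v => ?_)
    refine congrArg (Submodule.mkQ _) ?_
    rw [preMap_gen]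
    change _ = preMap k A β (preMap k A α _)
    rw [preMap_gen, preMap_gen]
    rfl

/-- The simplicial `k`-module `k[N(ES₂)]`. -/
noncomputable def Dsm : SimplicialObject (ModuleCat.{u} k) where
  obj Δ := ModuleCat.of k ((nerve D2).obj Δ →₀ k)
  map α := ModuleCat.ofHom (Finsupp.lmapDomain k k ((nerve D2).map α))
  map_id Δ := by
    ext1
    refine Finsupp.lhom_ext' fun s => LinearMap.ext_ring ?_
    exact Finsupp.mapDomain_single
  map_comp α β := by
    ext1
    refine Finsupp.lhom_ext' fun s => LinearMap.ext_ring ?_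
    refine Finsupp.mapDomain_single.trans ?_
    change _ = Finsupp.mapDomain _ (Finsupp.mapDomain _ (Finsupp.single s 1))
    rw [Finsupp.mapDomain_single, Finsupp.mapDomain_single]
    rfl


/-! ### The action of `k[N(ES₂)]` on `𝒴₊(A)` and the Pontryagin product -/

/-- The map induced by `μ` on nerves. -/
def mulChain {Δ : SimplexCategoryᵒᵖ} {m n : ℕ}
    (x : (nerve D2).obj Δ × (Chains m Δ × Chains n Δ)) : Chains (m + n) Δ :=
  Functor.prod' x.1 (Functor.prod' x.2.1 x.2.2) ⋙ mu ⟨m⟩ ⟨n⟩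

/-- The structure map on summands: `d ⊗ (s ⊗ v) ⊗ (t ⊗ w) ↦ μ(d, s, t) ⊗ (v ⊗ w)`. -/
noncomputable def chiComp (Δ : SimplexCategoryᵒᵖ) (m n : ℕ) :
    ((nerve D2).obj Δ →₀ k) ⊗[k]
      (((Chains m Δ →₀ k) ⊗[k] (⨂[k] _ : Fin m, A)) ⊗[k]
        ((Chains n Δ →₀ k) ⊗[k] (⨂[k] _ : Fin n, A))) →ₗ[k]
      (Chains (m + n) Δ →₀ k) ⊗[k] (⨂[k] _ : Fin (m + n), A) :=
  TensorProduct.map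
      (Finsupp.lmapDomain k k mulChain ∘ₗ (finsuppTensorFinsupp' k _ _).toLinearMap ∘ₗ
        TensorProduct.map LinearMap.id (finsuppTensorFinsupp' k _ _).toLinearMap)
      (juxt k A m n) ∘ₗ
    (TensorProduct.assoc k _ _ _).symm.toLinearMap ∘ₗ
    TensorProduct.map LinearMap.id (TensorProduct.tensorTensorTensorComm k _ _ _ _).toLinearMap

theorem chiComp_apply (Δ : SimplexCategoryᵒᵖ) (m n : ℕ) (d : (nerve D2).obj Δ)
    (s : Chains m Δ) (t : Chains n Δ) (v : ⨂[k] _ : Fin m, A) (w : ⨂[k] _ : Fin n, A) :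
    chiComp k A Δ m n (Finsupp.single d 1 ⊗ₜ
      ((Finsupp.single s 1 ⊗ₜ v) ⊗ₜ (Finsupp.single t 1 ⊗ₜ w))) =
      Finsupp.single (mulChain (d, (s, t))) 1 ⊗ₜ juxt k A m n (v ⊗ₜ w) := by
  simp [chiComp]

/-- The structure map on direct sums, as a trilinear map. -/
noncomputable def chiPre (Δ : SimplexCategoryᵒᵖ) :
    Pre k A Δ →ₗ[k] Pre k A Δ →ₗ[k] ((nerve D2).obj Δ →₀ k) →ₗ[k] Pre k A Δ :=
  DirectSum.toModule k ℕ _ fun m => LinearMap.flip <|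
    DirectSum.toModule k ℕ _ fun n => LinearMap.flip <| TensorProduct.curry <| LinearMap.flip <|
      TensorProduct.curry <|
        DirectSum.lof k ℕ (fun m => (Chains m Δ →₀ k) ⊗[k] (⨂[k] _ : Fin m, A)) (m + n) ∘ₗ
          chiComp k A Δ m n

theorem chiPre_gen (Δ : SimplexCategoryᵒᵖ) (m n : ℕ) (d : (nerve D2).obj Δ)
    (s : Chains m Δ) (t : Chains n Δ) (v : ⨂[k] _ : Fin m, A) (w : ⨂[k] _ : Fin n, A) :
    chiPre k A Δ (gen k A m s v) (gen k A n t w) (Finsupp.single d 1) =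
      gen k A (m + n) (mulChain (d, (s, t))) (juxt k A m n (v ⊗ₜ w)) := by
  rw [chiPre, gen, DirectSum.toModule_lof, LinearMap.flip_apply, gen, DirectSum.toModule_lof]
  simp only [LinearMap.flip_apply, TensorProduct.curry_apply, LinearMap.comp_apply, chiComp_apply]
  rfl

theorem pull_mul_left {Δ : SimplexCategoryᵒᵖ} {m m' n : ℕ} (h : (⟨m⟩ : NCSet) ⟶ ⟨m'⟩)
    (d : (nerve D2).obj Δ) (s : Chains m' Δ) (t : Chains n Δ) :
    mulChain (d, (pull h s, t)) = pull (m := m + n) (n := m' + n) (prodMap h (𝟙 (⟨n⟩ : NCSet)))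
      (mulChain (d, (s, t))) :=
  mu_left h d s t

theorem pull_mul_right {Δ : SimplexCategoryᵒᵖ} {m n n' : ℕ} (h : (⟨n⟩ : NCSet) ⟶ ⟨n'⟩)
    (d : (nerve D2).obj Δ) (s : Chains m Δ) (t : Chains n' Δ) :
    mulChain (d, (s, pull h t)) = pull (m := m + n) (n := m + n') (prodMap (𝟙 (⟨m⟩ : NCSet)) h)
      (mulChain (d, (s, t))) :=
  mu_right h d s t

theorem juxt_left {m m' n : ℕ} (h : (⟨m⟩ : NCSet) ⟶ ⟨m'⟩) (v : ⨂[k] _ : Fin m, A)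
    (w : ⨂[k] _ : Fin n, A) : juxt k A m' n (bar k A h v ⊗ₜ w) =
      bar k A (m := m + n) (n := m' + n) (prodMap h (𝟙 (⟨n⟩ : NCSet))) (juxt k A m n (v ⊗ₜ w)) := by
  have := LinearMap.congr_fun (bar_juxt k A h (𝟙 (⟨n⟩ : NCSet))) (v ⊗ₜ w)
  rw [LinearMap.comp_apply, LinearMap.comp_apply, TensorProduct.map_tmul, bar_id] at this
  exact this.symm

theorem juxt_right {m n n' : ℕ} (h : (⟨n⟩ : NCSet) ⟶ ⟨n'⟩) (v : ⨂[k] _ : Fin m, A)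
    (w : ⨂[k] _ : Fin n, A) : juxt k A m n' (v ⊗ₜ bar k A h w) =
      bar k A (m := m + n) (n := m + n') (prodMap (𝟙 (⟨m⟩ : NCSet)) h) (juxt k A m n (v ⊗ₜ w)) := by
  have := LinearMap.congr_fun (bar_juxt k A (𝟙 (⟨m⟩ : NCSet)) h) (v ⊗ₜ w)
  rw [LinearMap.comp_apply, LinearMap.comp_apply, TensorProduct.map_tmul, bar_id] at this
  exact this.symm

/-- The bilinear map induced on quotients by a bilinear map that vanishes on the submodules. -/
def liftBilin {R : Type u} [CommRing R] {M : Type w} {N : Type w₁} {P : Type w₂} [AddCommGroup M]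
    [Module R M] [AddCommGroup N] [Module R N] [AddCommGroup P] [Module R P]
    (M' : Submodule R M) (N' : Submodule R N) (f : M →ₗ[R] N →ₗ[R] P)
    (h₁ : M' ≤ LinearMap.ker f) (h₂ : ∀ x, N' ≤ LinearMap.ker (f x)) :
    (M ⧸ M') →ₗ[R] (N ⧸ N') →ₗ[R] P :=
  M'.liftQ
    { toFun := fun x => N'.liftQ (f x) (h₂ x)
      map_add' := fun x x' => by
        ext y
        simp
      map_smul' := fun c x => by
        ext y
        simp }
    (fun x hx => by
      rw [LinearMap.mem_ker]
      ext y
      have hx' : f x = 0 := h₁ hx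
      simp [hx'])

/-- The structure map from direct sums to the quotient. -/
noncomputable def chiPreQ (Δ : SimplexCategoryᵒᵖ) :
    Pre k A Δ →ₗ[k] Pre k A Δ →ₗ[k] ((nerve D2).obj Δ →₀ k) →ₗ[k] (Pre k A Δ ⧸ rel k A Δ) :=
  (chiPre k A Δ).compr₂ (LinearMap.llcomp k _ _ _ (rel k A Δ).mkQ)

theorem chiPreQ_gen (Δ : SimplexCategoryᵒᵖ) (m n : ℕ) (d : (nerve D2).obj Δ)
    (s : Chains m Δ) (t : Chains n Δ) (v : ⨂[k] _ : Fin m, A) (w : ⨂[k] _ : Fin n, A) :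
    chiPreQ k A Δ (gen k A m s v) (gen k A n t w) (Finsupp.single d 1) =
      (rel k A Δ).mkQ (gen k A (m + n) (mulChain (d, (s, t))) (juxt k A m n (v ⊗ₜ w))) := by
  rw [← chiPre_gen]
  rfl

theorem mkQ_rel (Δ : SimplexCategoryᵒᵖ) {m n : ℕ} (h : (⟨m⟩ : NCSet) ⟶ ⟨n⟩) (s : Chains n Δ)
    (v : ⨂[k] _ : Fin m, A) :
    (rel k A Δ).mkQ (gen k A m (pull h s) v) = (rel k A Δ).mkQ (gen k A n s (bar k A h v)) :=
  (Submodule.Quotient.eq _).2 (Submodule.subset_span ⟨m, n, h, s, v, rfl⟩)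

theorem chiPreQ_left (Δ : SimplexCategoryᵒᵖ) : rel k A Δ ≤ LinearMap.ker (chiPreQ k A Δ) := by
  refine Submodule.span_le.2 ?_
  rintro _ ⟨m, m', h, s, v, rfl⟩
  change chiPreQ k A Δ _ = 0
  rw [map_sub, sub_eq_zero]
  refine pre_ext k A fun n t w => Finsupp.lhom_ext' fun d => LinearMap.ext_ring ?_
  simp only [LinearMap.comp_apply, Finsupp.lsingle_apply]
  rw [chiPreQ_gen, chiPreQ_gen, pull_mul_left, juxt_left]
  exact mkQ_rel k A Δ _ _ _

theorem chiPreQ_right (Δ : SimplexCategoryᵒᵖ) (x : Pre k A Δ) :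
    rel k A Δ ≤ LinearMap.ker (chiPreQ k A Δ x) := by
  refine Submodule.span_le.2 ?_
  rintro _ ⟨n, n', h, t, w, rfl⟩
  change chiPreQ k A Δ x _ = 0
  rw [map_sub, sub_eq_zero]
  change (chiPreQ k A Δ).flip _ x = (chiPreQ k A Δ).flip _ x
  refine LinearMap.congr_fun ?_ x
  refine pre_ext k A fun m s v => Finsupp.lhom_ext' fun d => LinearMap.ext_ring ?_
  simp only [LinearMap.comp_apply, Finsupp.lsingle_apply, LinearMap.flip_apply]
  rw [chiPreQ_gen, chiPreQ_gen, pull_mul_right, juxt_right]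
  exact mkQ_rel k A Δ _ _ _

/-- The structure map on quotients, as a trilinear map. -/
noncomputable def chiBilin (Δ : SimplexCategoryᵒᵖ) :
    (Pre k A Δ ⧸ rel k A Δ) →ₗ[k] (Pre k A Δ ⧸ rel k A Δ) →ₗ[k]
      ((nerve D2).obj Δ →₀ k) →ₗ[k] (Pre k A Δ ⧸ rel k A Δ) :=
  liftBilin (rel k A Δ) (rel k A Δ) (chiPreQ k A Δ) (chiPreQ_left k A Δ) (chiPreQ_right k A Δ)

theorem chiBilin_gen (Δ : SimplexCategoryᵒᵖ) (m n : ℕ) (d : (nerve D2).obj Δ)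
    (s : Chains m Δ) (t : Chains n Δ) (v : ⨂[k] _ : Fin m, A) (w : ⨂[k] _ : Fin n, A) :
    chiBilin k A Δ ((rel k A Δ).mkQ (gen k A m s v)) ((rel k A Δ).mkQ (gen k A n t w))
      (Finsupp.single d 1) =
      (rel k A Δ).mkQ (gen k A (m + n) (mulChain (d, (s, t))) (juxt k A m n (v ⊗ₜ w))) :=
  chiPreQ_gen k A Δ m n d s t v w

/-- The structure map in a fixed simplicial degree. -/
noncomputable def chiLin (Δ : SimplexCategoryᵒᵖ) :
    ((nerve D2).obj Δ →₀ k) ⊗[k] ((Pre k A Δ ⧸ rel k A Δ) ⊗[k] (Pre k A Δ ⧸ rel k A Δ)) →ₗ[k]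
      (Pre k A Δ ⧸ rel k A Δ) :=
  TensorProduct.lift (LinearMap.flip (TensorProduct.lift (chiBilin k A Δ)))

theorem chiLin_gen (Δ : SimplexCategoryᵒᵖ) (m n : ℕ) (d : (nerve D2).obj Δ)
    (s : Chains m Δ) (t : Chains n Δ) (v : ⨂[k] _ : Fin m, A) (w : ⨂[k] _ : Fin n, A) :
    chiLin k A Δ (Finsupp.single d 1 ⊗ₜ
      ((rel k A Δ).mkQ (gen k A m s v) ⊗ₜ (rel k A Δ).mkQ (gen k A n t w))) =
      (rel k A Δ).mkQ (gen k A (m + n) (mulChain (d, (s, t))) (juxt k A m n (v ⊗ₜ w))) := by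
  rw [← chiBilin_gen]
  simp [chiLin]

/-- The simplicial structure on the quotient. -/
noncomputable abbrev yMap {Δ Δ' : SimplexCategoryᵒᵖ} (α : Δ ⟶ Δ') :
    (Pre k A Δ ⧸ rel k A Δ) →ₗ[k] (Pre k A Δ' ⧸ rel k A Δ') :=
  Submodule.mapQ _ _ (preMap k A α) (preMap_rel k A α)

theorem yMap_gen {Δ Δ' : SimplexCategoryᵒᵖ} (α : Δ ⟶ Δ') (m : ℕ) (s : Chains m Δ)
    (v : ⨂[k] _ : Fin m, A) : yMap k A α ((rel k A Δ).mkQ (gen k A m s v)) =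
      (rel k A Δ').mkQ (gen k A m ((nerve (K ⟨m⟩)).map α s) v) :=
  congrArg (rel k A Δ').mkQ (preMap_gen k A α m s v)

theorem chiLin_nat {Δ Δ' : SimplexCategoryᵒᵖ} (α : Δ ⟶ Δ') :
    chiLin k A Δ' ∘ₗ TensorProduct.map (Finsupp.lmapDomain k k ((nerve D2).map α))
      (TensorProduct.map (yMap k A α) (yMap k A α)) = yMap k A α ∘ₗ chiLin k A Δ := by
  refine TensorProduct.ext (Finsupp.lhom_ext' fun d => LinearMap.ext_ring ?_)
  refine TensorProduct.ext (Submodule.linearMap_qext _ (pre_ext k A fun m s v => ?_))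
  refine Submodule.linearMap_qext _ (pre_ext k A fun n t w => ?_)
  simp only [LinearMap.compr₂_apply, LinearMap.comp_apply, TensorProduct.mk_apply,
    TensorProduct.map_tmul, Finsupp.lsingle_apply, Finsupp.lmapDomain_apply,
    Finsupp.mapDomain_single, LinearMap.compr₂ₛₗ_apply]
  rw [yMap_gen, yMap_gen, chiLin_gen, chiLin_gen, yMap_gen]
  rfl

/-- The structure map `k[N(ES₂)] ⊗ 𝒴₊(A) ⊗ 𝒴₊(A) → 𝒴₊(A)` of simplicial `k`-modules. -/
noncomputable def chi : tens (Dsm k) (tens (Y k A) (Y k A)) ⟶ Y k A where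
  app Δ := ModuleCat.ofHom (chiLin k A Δ)
  naturality Δ Δ' α := by
    ext1
    exact chiLin_nat k A α

/-- The symmetric homology `HS_n(A)`. -/
abbrev HS (n : ℕ) : Type (max u v) := Homology (Y k A) n

/-- The augmentation of the `0`-chains of `k[N(ES₂)]`: the sum of the coefficients. It induces the
identification of the zeroth homology of `k[N(ES₂)]` with `k`. -/
noncomputable def aug : Deg (Dsm k) 0 →ₗ[k] k := Finsupp.lsum k fun _ => LinearMap.id

/-- The Pontryagin product `HS_p(A) ⊗ HS_q(A) → HS_{p+q}(A)` defined by a `0`-chain `c` of `k[N(ES₂)]`: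
`[x] ⊗ [y]` goes to the class of the image of `c ⊗ x ⊗ y` under the shuffle maps followed by `χ`.
The chain `c` is to be any one with augmentation `1`. -/
noncomputable def pontryagin (c : Deg (Dsm k) 0) (p q n : ℕ) (h : p + q = n) :
    HS k A p →ₗ[k] HS k A q →ₗ[k] HS k A n :=
  (homologyCross (Y k A) (Y k A) p q n h).compr₂
    (homologyMap (chi k A) n ∘ₗ
      homologyCross (Dsm k) (tens (Y k A) (Y k A)) 0 n n (Nat.zero_add n) (zeroClass (Dsm k) c))

/-- The identity of the one-element set (the object `[0]`), as a `0`-simplex. -/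
noncomputable def unitChain : Chains 1 (op (SimplexCategory.mk 0)) :=
  ComposableArrows.mk₀ (Under.mk (𝟙 (⟨1⟩ : NCSet)))

/-- The map `A → HS_0(A)`, which sends `a` to the class of `([0] → [0]) ⊗ a`. -/
noncomputable def zeroChain : A →ₗ[k] HS k A 0 := 
  zeroClass (Y k A) ∘ₗ (rel k A _).mkQ ∘ₗ
    DirectSum.lof k ℕ (fun m => (Chains m (op (SimplexCategory.mk 0)) →₀ k) ⊗[k]
      (⨂[k] _ : Fin m, A)) 1 ∘ₗ (TensorProduct.mk k _ _ (Finsupp.single unitChain 1)) ∘ₗ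
      (PiTensorProduct.subsingletonEquiv (R := k) (s := fun _ : Fin 1 => A) 0).symm.toLinearMap

/-- The algebra `A/([A,A])`, by the two-sided ideal generated by all commutators. -/
abbrev SymQuot (A : Type v) [Ring A] : Type v :=
  (TwoSidedIdeal.span {x : A | ∃ a b, x = a * b - b * a}).ringCon.Quotient

end Bar
end SymHom

/-! The isomorphism `HS_0(A) ≅ A/([A,A])` and the product on it.

`HS_0(A)` is the cokernel of `d_0 - d_1`. As the under-category `m \ ΔS₊` has the initial object
`id`, a `1`-simplex `id → f` shows that the class of `f ⊗ v` does not depend on `f : m → p`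
(`genClass_eq`). For `p = 1`, the tensor relation identifies this class with that of the image of
`v` in `A^{⊗1} = A`, that is, with `zeroChain` of the product of the factors of `v`, taken in any
order (`zeroChain_list_prod`). So `zeroChain : A → HS_0(A)` is surjective, and the two orders of
`x ⊗ a ⊗ b ⊗ y` that differ by the exchange of `a` and `b` show that it kills `x (ab - ba) y`, hence
the ideal `([A,A])`.

In the other direction, `A/([A,A])` is commutative, so multiplying all factors of a tensor, in
whatever order, is invariant under the symmetric bar construction (`symProd_bar`). Ignoring the
simplices, this gives an augmentation of the simplicial module `𝒴₊(A)` and a map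
`homologyAug : HS_0(A) → A/([A,A])`, which sends `zeroChain a` to the class of `a`. Being surjective
by this and injective by the above, it is an isomorphism.

The product is compared after applying `homologyAug`. In degree zero the shuffle maps are tensor
products, and the structure map juxtaposes tensors, whatever the permutation; the augmentation turns
juxtaposition into multiplication (`symProd_juxt`), so the chain `c` only contributes the sum of its
coefficients (`yAug_chiLin`, `homologyAug_pontryagin`). -/

namespace SymHom

/-! ### The zeroth homology of a simplicial module -/

section Homology
variable {k : Type u} [CommRing k]

theorem zeroClass_surjective (X : SimplicialObject (ModuleCat.{w} k)) :
    Function.Surjective (zeroClass X) := by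
  intro z
  obtain ⟨⟨y, hy⟩, rfl⟩ := Submodule.mkQ_surjective _ z
  obtain ⟨x, rfl⟩ := Submodule.mkQ_surjective _ y
  exact ⟨x, rfl⟩

theorem zeroClass_face (X : SimplicialObject (ModuleCat.{w} k)) (x : Deg X 1) :
    zeroClass X (face X 0 0 x) = zeroClass X (face X 0 1 x) := by
  refine (Submodule.Quotient.eq _).2 ?_
  refine ⟨(degenerate (degen X) 1).mkQ x, congrArg (degenerate (degen X) 0).mkQ ?_⟩
  rw [bdry_eq]
  simp [tail]

/-- A linear map on `0`-simplices that coequalizes the two faces descends to the zeroth homology. -/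
noncomputable def homologyZeroLift (X : SimplicialObject (ModuleCat.{w} k)) {M : Type w₁}
    [AddCommGroup M] [Module k M] (f : Deg X 0 →ₗ[k] M)
    (hf : ∀ x, f (face X 0 0 x) = f (face X 0 1 x)) : Homology X 0 →ₗ[k] M :=
  Submodule.liftQ _ ((degenerate (degen X) 0).liftQ f bot_le ∘ₗ (cycles X 0).subtype) (by
    rintro ⟨_, hx⟩ ⟨z, rfl⟩
    obtain ⟨x, rfl⟩ := Submodule.mkQ_surjective _ z
    change f (bdry (face X) 0 x) = 0
    rw [bdry_eq, map_sub, hf]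
    simp [tail])

/-- In degree zero there is only one shuffle, and the cross product is the tensor product. -/
theorem homologyCross_zeroClass (X : SimplicialObject (ModuleCat.{w₁} k))
    (Y : SimplicialObject (ModuleCat.{w₂} k)) (x : Deg X 0) (y : Deg Y 0) (h : 0 + 0 = 0) :
    homologyCross X Y 0 0 0 h (zeroClass X x) (zeroClass Y y) =
      zeroClass (tens X Y) (x ⊗ₜ[k] y) := by
  have e : degShuffle X Y 0 0 0 h x y = x ⊗ₜ[k] y := shuffle_zero x y h
  rw [← e]
  rfl

end Homology

section Bar
variable (k : Type u) [CommRing k] (A : Type v) [Ring A] [Algebra k A]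

/-! ### The abelianization of the algebra -/

theorem symQuot_coe_eq_zero {a : A} :
    (a : SymQuot A) = 0 ↔ a ∈ TwoSidedIdeal.span {x : A | ∃ a b, x = a * b - b * a} := by
  rw [TwoSidedIdeal.mem_iff]
  exact RingCon.eq _

instance : CommRing (SymQuot A) where
  mul_comm x y := by
    obtain ⟨a, rfl⟩ := RingCon.mk'_surjective _ x
    obtain ⟨b, rfl⟩ := RingCon.mk'_surjective _ y
    rw [← sub_eq_zero]
    exact (symQuot_coe_eq_zero A).2 (TwoSidedIdeal.subset_span ⟨a, b, rfl⟩)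

/-- The projection `A → A/([A,A])`. -/
def symProj : A →ₐ[k] SymQuot A := RingCon.mkₐ k _

/-- The map `A^{⊗m} → A/([A,A])` that sends a tensor to the product of its factors. -/
noncomputable def symProd (m : ℕ) : (⨂[k] _ : Fin m, A) →ₗ[k] SymQuot A :=
  PiTensorProduct.lift ((MultilinearMap.mkPiAlgebra k (Fin m) (SymQuot A)).compLinearMap
    fun _ => (symProj k A).toLinearMap)

theorem symProd_tprod (m : ℕ) (a : Fin m → A) :
    symProd k A m (PiTensorProduct.tprod k a) = ∏ i, symProj k A (a i) := by
  simp [symProd]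

/-- As `A/([A,A])` is commutative, the orders of the fibres do not matter there, and the product of
all factors is invariant under the symmetric bar construction. -/
theorem symProd_bar {m n : ℕ} (f : (⟨m⟩ : NCSet) ⟶ ⟨n⟩) (v : ⨂[k] _ : Fin m, A) :
    symProd k A n (bar k A f v) = symProd k A m v := by
  suffices h : symProd k A n ∘ₗ bar k A f = symProd k A m from LinearMap.congr_fun h v
  refine PiTensorProduct.ext (MultilinearMap.ext fun a => ?_)
  simp only [LinearMap.compMultilinearMap_apply, LinearMap.comp_apply, bar_tprod, symProd_tprod,
    map_list_prod, List.map_map]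
  rw [← Finset.prod_fiberwise (s := Finset.univ) (g := NCMap.toFun f)]
  refine Finset.prod_congr rfl fun y _ => ?_
  rw [← List.prod_toFinset _ (NCMap.nodup_fib f y)]
  refine Finset.prod_congr ?_ fun _ _ => rfl
  ext x
  simp [NCMap.mem_fib f]

/-! ### The augmentation of `𝒴₊(A)` -/

/-- The map `s ⊗ v ↦ symProd v` on the direct sum. -/
noncomputable def preAug (Δ : SimplexCategoryᵒᵖ) : Pre k A Δ →ₗ[k] SymQuot A :=
  DirectSum.toModule k ℕ _ fun m =>
    TensorProduct.lift (Finsupp.lsum k fun _ => LinearMap.toSpanSingleton k _ (symProd k A m))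

theorem preAug_gen (Δ : SimplexCategoryᵒᵖ) (m : ℕ) (s : Chains m Δ) (v : ⨂[k] _ : Fin m, A) :
    preAug k A Δ (gen k A m s v) = symProd k A m v := by
  simp [preAug, gen]

/-- The map `𝒴₊(A) → A/([A,A])` in a fixed simplicial degree. -/
noncomputable def yAug (Δ : SimplexCategoryᵒᵖ) : (Pre k A Δ ⧸ rel k A Δ) →ₗ[k] SymQuot A :=
  (rel k A Δ).liftQ (preAug k A Δ) (Submodule.span_le.2 (by
    rintro _ ⟨m, n, h, s, v, rfl⟩
    change preAug k A Δ _ = 0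
    rw [map_sub, preAug_gen, preAug_gen, symProd_bar, sub_self]))

theorem yAug_gen (Δ : SimplexCategoryᵒᵖ) (m : ℕ) (s : Chains m Δ) (v : ⨂[k] _ : Fin m, A) :
    yAug k A Δ ((rel k A Δ).mkQ (gen k A m s v)) = symProd k A m v :=
  preAug_gen k A Δ m s v

theorem yAug_yMap {Δ Δ' : SimplexCategoryᵒᵖ} (α : Δ ⟶ Δ') (x : Pre k A Δ ⧸ rel k A Δ) :
    yAug k A Δ' (yMap k A α x) = yAug k A Δ x := by
  suffices h : yAug k A Δ' ∘ₗ yMap k A α = yAug k A Δ from LinearMap.congr_fun h x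
  refine Submodule.linearMap_qext _ (pre_ext k A fun m s v => ?_)
  simp only [LinearMap.comp_apply]
  rw [yMap_gen, yAug_gen, yAug_gen]

/-- The map `HS_0(A) → A/([A,A])` that multiplies the factors of a tensor. -/
noncomputable def homologyAug : HS k A 0 →ₗ[k] SymQuot A :=
  homologyZeroLift (Y k A) (yAug k A _) fun x =>
    (yAug_yMap k A (SimplexCategory.δ 0).op x).trans (yAug_yMap k A (SimplexCategory.δ 1).op x).symm

/-! ### Classes of generators -/

/-- The class in `HS_0(A)` of the generator `s ⊗ v`. -/
noncomputable def genClass (m : ℕ) (s : Chains m (op (SimplexCategory.mk 0)))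
    (v : ⨂[k] _ : Fin m, A) : HS k A 0 :=
  zeroClass (Y k A) ((rel k A _).mkQ (gen k A m s v))

theorem homologyAug_genClass (m : ℕ) (s : Chains m (op (SimplexCategory.mk 0)))
    (v : ⨂[k] _ : Fin m, A) : homologyAug k A (genClass k A m s v) = symProd k A m v :=
  preAug_gen k A _ m s v

theorem genClass_bar {m n : ℕ} (h : (⟨m⟩ : NCSet) ⟶ ⟨n⟩)
    (s : Chains n (op (SimplexCategory.mk 0))) (v : ⨂[k] _ : Fin m, A) :
    genClass k A n s (bar k A h v) = genClass k A m (pull h s) v :=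
  congrArg (zeroClass (Y k A)) (mkQ_rel k A _ h s v).symm

/-- Objects of `m \ ΔS₊` joined by a morphism give homologous generators. -/
theorem genClass_eq_of_hom {m : ℕ} {X X' : K ⟨m⟩} (f : X ⟶ X') (v : ⨂[k] _ : Fin m, A) :
    genClass k A m (ComposableArrows.mk₀ X) v = genClass k A m (ComposableArrows.mk₀ X') v := by
  have key := zeroClass_face (Y k A)
    ((rel k A (op (SimplexCategory.mk 1))).mkQ (gen k A m (ComposableArrows.mk₁ f) v))
  have h0 := yMap_gen k A (SimplexCategory.δ (n := 0) 0).op m (ComposableArrows.mk₁ f) v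
  have h1 := yMap_gen k A (SimplexCategory.δ (n := 0) 1).op m (ComposableArrows.mk₁ f) v
  have e0 : (nerve (K ⟨m⟩)).map (SimplexCategory.δ (n := 0) 0).op (ComposableArrows.mk₁ f) =
      ComposableArrows.mk₀ X' := ComposableArrows.ext₀ rfl
  have e1 : (nerve (K ⟨m⟩)).map (SimplexCategory.δ (n := 0) 1).op (ComposableArrows.mk₁ f) =
      ComposableArrows.mk₀ X := ComposableArrows.ext₀ rfl
  rw [e0] at h0
  rw [e1] at h1
  exact (congrArg (zeroClass (Y k A)) h1).symm.trans
    (key.symm.trans (congrArg (zeroClass (Y k A)) h0))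

/-- Since `m \ ΔS₊` has an initial object, the class of `s ⊗ v` does not depend on `s`. -/
theorem genClass_eq {m : ℕ} (s s' : Chains m (op (SimplexCategory.mk 0)))
    (v : ⨂[k] _ : Fin m, A) : genClass k A m s v = genClass k A m s' v := by
  have h : ∀ s : Chains m (op (SimplexCategory.mk 0)),
      genClass k A m (ComposableArrows.mk₀ (Under.mk (𝟙 (⟨m⟩ : NCSet)))) v =
        genClass k A m s v := fun s => by
    obtain ⟨X, rfl⟩ := ComposableArrows.mk₀_surjective s
    exact genClass_eq_of_hom k A (Under.homMk X.hom) v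
  exact (h s).symm.trans (h s')

theorem zeroChain_eq_genClass (a : A) :
    zeroChain k A a = genClass k A 1 unitChain
      ((PiTensorProduct.subsingletonEquiv (R := k) (s := fun _ : Fin 1 => A) 0).symm a) :=
  rfl

theorem subsingletonEquiv_symm_eq_tprod (a : A) :
    (PiTensorProduct.subsingletonEquiv (R := k) (s := fun _ : Fin 1 => A) 0).symm a =
      PiTensorProduct.tprod k fun _ => a := by
  rw [LinearEquiv.symm_apply_eq]
  simp

/-- An enumeration of a finite set, as a morphism to the one-element set. -/
def ofEnum {m : ℕ} (l : List (Fin m)) (hl : l.Nodup) (hm : ∀ i, i ∈ l) :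
    (⟨m⟩ : NCSet) ⟶ ⟨1⟩ :=
  NCMap.mk (fun _ => 0) (fun _ => l) (fun _ => hl) (fun i y => by
    simpa [hm i] using Subsingleton.elim (α := Fin 1) 0 y)

/-- The product of the factors in any order whatsoever gives the class of the tensor. -/
theorem zeroChain_list_prod {m : ℕ} (l : List (Fin m)) (hl : l.Nodup) (hm : ∀ i, i ∈ l)
    (a : Fin m → A) (s : Chains m (op (SimplexCategory.mk 0))) :
    zeroChain k A (l.map a).prod = genClass k A m s (PiTensorProduct.tprod k a) := by
  rw [zeroChain_eq_genClass, subsingletonEquiv_symm_eq_tprod,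
    genClass_eq k A s (pull (ofEnum l hl hm) unitChain), ← genClass_bar, bar_tprod]
  rfl

theorem zeroChain_surjective : Function.Surjective (zeroChain k A) := by
  rw [← LinearMap.range_eq_top, ← top_le_iff]
  rintro z -
  obtain ⟨y, rfl⟩ := zeroClass_surjective _ z
  obtain ⟨x, rfl⟩ := Submodule.mkQ_surjective _ y
  suffices h : (LinearMap.range (zeroChain k A)).mkQ ∘ₗ zeroClass (Y k A) ∘ₗ (rel k A _).mkQ = 0 from
    (Submodule.Quotient.mk_eq_zero _).1 (LinearMap.congr_fun h x)
  refine pre_ext k A fun m s v => (Submodule.Quotient.mk_eq_zero _).2 ?_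
  -- Any morphism from `m` to the one-element set moves `v` into `A^{⊗1} = A`.
  let f : (⟨m⟩ : NCSet) ⟶ ⟨1⟩ := ofEnum (List.finRange m) (List.nodup_finRange m) List.mem_finRange
  refine ⟨PiTensorProduct.subsingletonEquiv (R := k) (s := fun _ : Fin 1 => A) 0 (bar k A f v), ?_⟩
  rw [zeroChain_eq_genClass, LinearEquiv.symm_apply_apply, genClass_bar]
  exact genClass_eq k A _ s v

/-- Both `x a b y` and `x b a y` are products of the factors of `x ⊗ a ⊗ b ⊗ y`. -/
theorem zeroChain_mul_swap (x a b y : A) :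
    zeroChain k A (x * (a * b) * y) = zeroChain k A (x * (b * a) * y) := by
  have h1 := zeroChain_list_prod k A [0, 1, 2, 3] (by decide) (by decide) ![x, a, b, y]
    (ComposableArrows.mk₀ (Under.mk (𝟙 (⟨4⟩ : NCSet))))
  have h2 := zeroChain_list_prod k A [0, 2, 1, 3] (by decide) (by decide) ![x, a, b, y]
    (ComposableArrows.mk₀ (Under.mk (𝟙 (⟨4⟩ : NCSet))))
  simpa [mul_assoc] using h1.trans h2.symm

theorem zeroChain_eq_zero {a : A}
    (ha : a ∈ TwoSidedIdeal.span {x : A | ∃ a b, x = a * b - b * a}) : zeroChain k A a = 0 := by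
  -- The elements `r` such that all `x r y` go to zero form a two-sided ideal.
  have h := TwoSidedIdeal.span_le (I := TwoSidedIdeal.mk'
    {r : A | ∀ x y, zeroChain k A (x * r * y) = 0} (by simp)
    (fun hr hs x y => by rw [mul_add, add_mul, map_add, hr, hs, add_zero])
    (fun hr x y => by rw [mul_neg, neg_mul, map_neg, hr, neg_zero])
    (fun {z r} hr x y => by rw [← mul_assoc]; exact hr _ _)
    (fun {r z} hr x y => by rw [← mul_assoc, mul_assoc]; exact hr _ _)).2 (by
      rintro _ ⟨a, b, rfl⟩
      rw [TwoSidedIdeal.coe_mk']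
      intro x y
      rw [mul_sub, sub_mul, map_sub, zeroChain_mul_swap, sub_self]) ha
  simpa using (TwoSidedIdeal.mem_mk' _ _ _ _ _ _ _).1 h 1 1

theorem homologyAug_zeroChain (a : A) : homologyAug k A (zeroChain k A a) = symProj k A a := by
  rw [zeroChain_eq_genClass, homologyAug_genClass,
    subsingletonEquiv_symm_eq_tprod, symProd_tprod]
  simp

theorem homologyAug_injective : Function.Injective (homologyAug k A) := by
  rw [injective_iff_map_eq_zero]
  intro z hz
  obtain ⟨a, rfl⟩ := zeroChain_surjective k A z
  rw [homologyAug_zeroChain] at hz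
  exact zeroChain_eq_zero k A ((symQuot_coe_eq_zero A).1 hz)

theorem homologyAug_surjective : Function.Surjective (homologyAug k A) := fun x => by
  obtain ⟨a, rfl⟩ := RingCon.mkₐ_surjective (α := k) _ x
  exact ⟨zeroChain k A a, homologyAug_zeroChain k A a⟩

/-! ### The product in degree zero -/

theorem pontryagin_zeroClass (c : Deg (Dsm k) 0) (x y : Deg (Y k A) 0) :
    pontryagin k A c 0 0 0 (Nat.add_zero 0) (zeroClass (Y k A) x) (zeroClass (Y k A) y) =
      zeroClass (Y k A) (chiLin k A _ (c ⊗ₜ (x ⊗ₜ y))) := by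
  simp only [pontryagin, LinearMap.compr₂_apply, LinearMap.comp_apply, homologyCross_zeroClass]
  rfl

theorem symProd_juxt (m n : ℕ) (v : ⨂[k] _ : Fin m, A) (w : ⨂[k] _ : Fin n, A) :
    symProd k A (m + n) (juxt k A m n (v ⊗ₜ w)) = symProd k A m v * symProd k A n w := by
  suffices h : symProd k A (m + n) ∘ₗ juxt k A m n =
      TensorProduct.lift ((LinearMap.mul k (SymQuot A)).compl₁₂ (symProd k A m) (symProd k A n)) from
    LinearMap.congr_fun h (v ⊗ₜ w)
  refine TensorProduct.ext (PiTensorProduct.ext (MultilinearMap.ext fun a =>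
    PiTensorProduct.ext (MultilinearMap.ext fun b => ?_)))
  change symProd k A (m + n) (juxt k A m n (PiTensorProduct.tprod k a ⊗ₜ
      PiTensorProduct.tprod k b)) =
    symProd k A m (PiTensorProduct.tprod k a) * symProd k A n (PiTensorProduct.tprod k b)
  rw [juxt_tprod, symProd_tprod, symProd_tprod, symProd_tprod, Fin.prod_univ_add]
  simp

/-- The structure map is multiplicative up to the augmentation of the chain of `k[N(ES₂)]`. -/
theorem yAug_chiLin (Δ : SimplexCategoryᵒᵖ) (c : (nerve D2).obj Δ →₀ k)
    (x y : Pre k A Δ ⧸ rel k A Δ) :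
    yAug k A Δ (chiLin k A Δ (c ⊗ₜ (x ⊗ₜ y))) =
      Finsupp.lsum k (fun _ => (LinearMap.id : k →ₗ[k] k)) c • (yAug k A Δ x * yAug k A Δ y) := by
  suffices h : yAug k A Δ ∘ₗ chiLin k A Δ =
      TensorProduct.lift ((LinearMap.lsmul k (SymQuot A)).compl₁₂
        (Finsupp.lsum k fun _ => (LinearMap.id : k →ₗ[k] k))
        (TensorProduct.lift ((LinearMap.mul k (SymQuot A)).compl₁₂ (yAug k A Δ) (yAug k A Δ)))) from
    LinearMap.congr_fun h (c ⊗ₜ (x ⊗ₜ y))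
  refine TensorProduct.ext (Finsupp.lhom_ext' fun d => LinearMap.ext_ring ?_)
  refine TensorProduct.ext (Submodule.linearMap_qext _ (pre_ext k A fun m s v => ?_))
  refine Submodule.linearMap_qext _ (pre_ext k A fun n t w => ?_)
  change yAug k A Δ (chiLin k A Δ (Finsupp.single d 1 ⊗ₜ
      ((rel k A Δ).mkQ (gen k A m s v) ⊗ₜ (rel k A Δ).mkQ (gen k A n t w)))) =
    Finsupp.lsum k (fun _ => (LinearMap.id : k →ₗ[k] k)) (Finsupp.single d 1) •
      (yAug k A Δ ((rel k A Δ).mkQ (gen k A m s v)) * yAug k A Δ ((rel k A Δ).mkQ (gen k A n t w)))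
  rw [chiLin_gen, yAug_gen, yAug_gen, yAug_gen, symProd_juxt]
  simp

theorem homologyAug_pontryagin (c : Deg (Dsm k) 0) (x y : HS k A 0) :
    homologyAug k A (pontryagin k A c 0 0 0 (Nat.add_zero 0) x y) =
      aug k c • (homologyAug k A x * homologyAug k A y) := by
  obtain ⟨x, rfl⟩ := zeroClass_surjective _ x
  obtain ⟨y, rfl⟩ := zeroClass_surjective _ y
  rw [pontryagin_zeroClass]
  exact yAug_chiLin k A _ c x y

/-- The isomorphism `HS_0(A) ≅ A/([A,A])`. -/
noncomputable def homologyAugEquiv : HS k A 0 ≃ₗ[k] SymQuot A :=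
  LinearEquiv.ofBijective (homologyAug k A)
    ⟨homologyAug_injective k A, homologyAug_surjective k A⟩

end Bar
end SymHom

theorem mainTheorem6 (k : Type u) [CommRing k] (A : Type v) [Ring A] [Algebra k A] :
    ∃ Φ : SymHom.SymQuot A ≃ₗ[k] SymHom.HS k A 0,
      (∀ a : A, Φ (a : SymHom.SymQuot A) = SymHom.zeroChain k A a) ∧
      ∀ c : SymHom.Deg (SymHom.Dsm k) 0, SymHom.aug k c = 1 →
        ∀ x y : SymHom.SymQuot A,
          SymHom.pontryagin k A c 0 0 0 (Nat.add_zero 0) (Φ x) (Φ y) = Φ (x * y) := by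
  refine ⟨(SymHom.homologyAugEquiv k A).symm, fun a => ?_, fun c hc x y => ?_⟩
  · rw [LinearEquiv.symm_apply_eq]
    exact (SymHom.homologyAug_zeroChain k A a).symm
  · rw [LinearEquiv.eq_symm_apply]
    refine (SymHom.homologyAug_pontryagin k A c _ _).trans ?_
    rw [hc, one_smul]
    exact congrArg₂ _ ((SymHom.homologyAugEquiv k A).apply_symm_apply x)
      ((SymHom.homologyAugEquiv k A).apply_symm_apply y)
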